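/- Let $\mathcal E$ and $\mathcal E_c$ be two ellipses in the plane, with $\mathcal E_c$ contained in the open region bounded by $\mathcal E$, and suppose that $\mathcal E$ is not a circle (if it is, all circumcenters below coincide). Suppose that some triangle is inscribed in $\mathcal E$ with its three side lines tangent to $\mathcal E_c$, and let $\mathcal T$ be the family of all such (Poncelet) triangles. Let $\mathcal K$ be a circle with center $O$ and radius $r>0$. For $T=ABC\in\mathcal T$ let $X_3$ be its circumcenter and, when $O$ is not on the circumcircle of $T$, let $X_3'$ be the circumcenter of the inversive triangle $T'=A'B'C'$, whose vertices are the inverses of $A,B,C$ in $\mathcal K$. Let $\mathcal L_3$ and $\mathcal L_3'$ be the loci of $X_3$ and $X_3'$ over $\mathcal T$. For two circles with centers $c,c'$ and radii $R,R'>0$, a common internal tangent is a (real or complex) line tangent to both whose linear form $u$ satisfies $R'u(c)=-R\,u(c')$ (for a real line: the circles lie on opposite sides of it), and the internal similitude center is the point $Z$ such that the common internal tangents are exactly the tangents from $Z$ to either circle; equivalently, $Z$ is the center of the homothety of ratio $-R'/R$ that takes the first circle to the second. For conics the notion is transported by projective transformations of the plane. Then $\mathcal L_3$ and $\mathcal L_3'$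 are (the sets of affine points of) nondegenerate real conics, and $O$ is their internal similitude center, in the following sense. 1. The (real or complex) tangent lines from $O$ to $\mathcal L_3$ are exactly the tangent lines from $O$ to $\mathcal L_3'$. The point $O$ lies on one conic if and only if it lies on the other, and if it does not, there are two distinct such common tangents, which therefore meet at $O$. 2. There are a real projective transformation $S$, which sends $O$ to a finite point $Z$, and a number $k<0$ such that the homothety $h$ with center $Z$ and ratio $k$ takes the conic $S(\mathcal L_3)$ to the conic $S(\mathcal L_3')$. Moreover $h(S(X_3))=S(X_3')$ (as points of the projective plane) for every $T\in\mathcal T$ for which $X_3'$ is defined. 3. If no circumcircle of a triangle of $\mathcal T$ is orthogonal to $\mathcal K$ (that is, $|OX_3|^2-R_T^2\ne r^2$ for all $T\in\mathcal T$, where $R_T$ is the circumradius of $T$), then some real projective transformation sends $\mathcal L_3$ and $\mathcal L_3'$ to two circles and $O$ to the internal similitude center of these circles. 4. If $O$ is inside the circumcircle of every $T\in\mathcal T$, then every real tangent line from $O$ to $\mathcal L_3$ is an internal common tangent in the literal sense: $\mathcal L_3$ and $\mathcal L_3'$ lie in opposite closed half-planes of it. -/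

import Mathlib

open scoped Matrix

/-- The ellipse `A(𝕋)`: the image of the unit circle of the plane `ℂ = ℝ²` under an invertible real
affine map `A`. Every ellipse (circles included) is of this form. -/
def ellipse (A : ℂ ≃ᵃ[ℝ] ℂ) : Set ℂ := A '' Metric.sphere 0 1

/-- The open region enclosed by the ellipse `A(𝕋)`. -/
def ellipseInside (A : ℂ ≃ᵃ[ℝ] ℂ) : Set ℂ := A '' Metric.ball 0 1

/-- `T` is a Poncelet triangle of the pair `(A(𝕋), B(𝕋))`: its vertices lie on the ellipse `A(𝕋)`
and its three side lines are tangent to the ellipse `B(𝕋)`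
(a line is tangent to an ellipse iff it meets it in exactly one point). -/
def IsPonceletTriangle (A B : ℂ ≃ᵃ[ℝ] ℂ) (T : Affine.Triangle ℝ ℂ) : Prop :=
  (∀ i, T.points i ∈ ellipse A) ∧
    ∀ i j, i ≠ j → ∃! P : ℂ, P ∈ ellipse B ∧ P ∈ line[ℝ, T.points i, T.points j]

/-- `T'` is the inversive triangle of `T` with respect to the circle with centre `O` and radius `r`.
The triangle `T'` is nondegenerate by its type, so this forces `O` off the circumcircle of `T`. -/
def IsInversiveTriangle (O : ℂ) (r : ℝ) (T T' : Affine.Triangle ℝ ℂ) : Prop :=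
  ∀ i, T.points i ≠ O ∧ T'.points i = EuclideanGeometry.inversion O r (T.points i)

/-- The locus of the circumcenter over the Poncelet family. -/
def circumLocus (A B : ℂ ≃ᵃ[ℝ] ℂ) : Set ℂ :=
  {X | ∃ T : Affine.Triangle ℝ ℂ, IsPonceletTriangle A B T ∧ X = T.circumcenter}

/-- The locus of the circumcenter of the inversive triangle over the Poncelet family. -/
def invCircumLocus (A B : ℂ ≃ᵃ[ℝ] ℂ) (O : ℂ) (r : ℝ) : Set ℂ :=
  {X | ∃ T T' : Affine.Triangle ℝ ℂ,
    IsPonceletTriangle A B T ∧ IsInversiveTriangle O r T T' ∧ X = T'.circumcenter}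

/-- Homogeneous coordinates `[x : y : 1]` of the point `x + iy`. -/
def homPt (z : ℂ) : Fin 3 → ℝ := ![z.re, z.im, 1]

/-- The same homogeneous coordinates, in the complex projective plane. -/
def homPtC (z : ℂ) : Fin 3 → ℂ := fun i => (homPt z i : ℂ)

/-- The complexification of a real `3 × 3` matrix. -/
def cplx (M : Matrix (Fin 3) (Fin 3) ℝ) : Matrix (Fin 3) (Fin 3) ℂ := M.map (fun x => (x : ℂ))

/-- The vector `p` of homogeneous coordinates satisfies the equation `pᵀ M p = 0` of the conic `M`. -/
def OnConic {F : Type*} [Field F] (M : Matrix (Fin 3) (Fin 3) F) (p : Fin 3 → F) : Prop :=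
  p ⬝ᵥ (M *ᵥ p) = 0

/-- The line `{x | u ⬝ x = 0}` is tangent to the nondegenerate conic `M`: it is the polar line of
a point `p` of the conic. -/
def IsTangentLine {F : Type*} [Field F] (M : Matrix (Fin 3) (Fin 3) F) (u : Fin 3 → F) : Prop :=
  u ≠ 0 ∧ ∃ p : Fin 3 → F, OnConic M p ∧ u = M *ᵥ p

/-- The set `L` of the plane is (the set of all affine points of) a real nondegenerate conic with
real points, and `M` is its matrix (which `L` determines up to a scalar). -/
def IsConicWithMatrix (L : Set ℂ) (M : Matrix (Fin 3) (Fin 3) ℝ) : Prop :=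
  M.IsSymm ∧ M.det ≠ 0 ∧ L.Nonempty ∧ L = {z | OnConic M (homPt z)}

/-- The conics `M` and `M'` have the same tangent lines (real or complex) through `O`; there
are two of them if `O` does not lie on the conics. -/
def CommonTangentsMeetAt (M M' : Matrix (Fin 3) (Fin 3) ℝ) (O : ℂ) : Prop :=
  (∀ u : Fin 3 → ℂ, u ⬝ᵥ homPtC O = 0 →
    (IsTangentLine (cplx M) u ↔ IsTangentLine (cplx M') u)) ∧
  (OnConic M (homPt O) ↔ OnConic M' (homPt O)) ∧
  (¬ OnConic M (homPt O) → ∃ u v : Fin 3 → ℂ, LinearIndependent ℂ ![u, v] ∧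
    u ⬝ᵥ homPtC O = 0 ∧ v ⬝ᵥ homPtC O = 0 ∧
    IsTangentLine (cplx M) u ∧ IsTangentLine (cplx M') u ∧
    IsTangentLine (cplx M) v ∧ IsTangentLine (cplx M') v)

/-- In homogeneous coordinates, the homothety with centre at the origin `[0 : 0 : 1]` and ratio `k`. -/
def homothetyMatrix (k : ℝ) : Matrix (Fin 3) (Fin 3) ℝ := Matrix.diagonal ![k, k, 1]

/-- The projective transformation `S` sends `O` to the origin and turns `M` and `M'` into two
conics such that the homothety of negative ratio `k` centred at the origin carries the first to the
second: the image of `O` is an internal centre of similitude of the two image conics. -/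
def IsInternalSimilitudeChart (M M' : Matrix (Fin 3) (Fin 3) ℝ) (O : ℂ)
    (S : Matrix (Fin 3) (Fin 3) ℝ) (k : ℝ) : Prop :=
  S.det ≠ 0 ∧ k < 0 ∧ S *ᵥ homPt O = homPt 0 ∧
    ∀ p q : Fin 3 → ℝ, S *ᵥ q = homothetyMatrix k *ᵥ (S *ᵥ p) → (OnConic M p ↔ OnConic M' q)

/-- The matrix of the circle `(x - c₁)² + (y - c₂)² = R²`. -/
def circleMatrix (c : ℂ) (R : ℝ) : Matrix (Fin 3) (Fin 3) ℝ :=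
  !![1, 0, -c.re; 0, 1, -c.im; -c.re, -c.im, c.re ^ 2 + c.im ^ 2 - R ^ 2]

/-- The line `u` is a common internal tangent of the circles `(c, R)` and `(c', R')`: it is tangent to
both, and the values of the linear form `u` at the two centres have opposite signs (being, up to
sign, in the ratio `R : R'`; in this form the condition also makes sense for complex lines). -/
def IsInternalCommonTangent (c c' : ℂ) (R R' : ℝ) (u : Fin 3 → ℂ) : Prop :=
  IsTangentLine (cplx (circleMatrix c R)) u ∧ IsTangentLine (cplx (circleMatrix c' R')) u ∧
    (R' : ℂ) * (u ⬝ᵥ homPtC c) = -((R : ℂ) * (u ⬝ᵥ homPtC c'))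

/-- `Z` is the internal similitude centre of the circles `(c, R)` and `(c', R')`: their common
internal tangents are exactly the tangents from `Z` to either circle. -/
def IsInternalSimilitudeCenter (c c' : ℂ) (R R' : ℝ) (Z : ℂ) : Prop :=
  ∀ u : Fin 3 → ℂ,
    (IsInternalCommonTangent c c' R R' u ↔
      u ⬝ᵥ homPtC Z = 0 ∧ IsTangentLine (cplx (circleMatrix c R)) u) ∧
    (IsInternalCommonTangent c c' R R' u ↔
      u ⬝ᵥ homPtC Z = 0 ∧ IsTangentLine (cplx (circleMatrix c' R')) u)

/-- Some real projective transformation sends the conics `M` and `M'` to two circles, and `O` to the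
internal similitude centre of these circles. -/
def IsInternalSimilitudeCenterViaCircles (M M' : Matrix (Fin 3) (Fin 3) ℝ) (O : ℂ) : Prop :=
  ∃ (S : Matrix (Fin 3) (Fin 3) ℝ) (c c' : ℂ) (R R' : ℝ) (Z : ℂ),
    S.det ≠ 0 ∧ 0 < R ∧ 0 < R' ∧
    (∀ p : Fin 3 → ℝ, OnConic M p ↔ OnConic (circleMatrix c R) (S *ᵥ p)) ∧
    (∀ p : Fin 3 → ℝ, OnConic M' p ↔ OnConic (circleMatrix c' R') (S *ᵥ p)) ∧
    (∃ s : ℝ, s ≠ 0 ∧ S *ᵥ homPt O = s • homPt Z) ∧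
    IsInternalSimilitudeCenter c c' R R' Z

/-! An affine chart turns the outer ellipse into the unit circle. Let f, g be the foci of the inner
ellipse in that chart. A chord z₁z₂ is tangent to it iff the product of the distances from the foci
to the chord is the squared semi-minor axis, a polynomial relation in z₁, z₂. For a triangle these
relations say that its vertices are a fibre z(z - f)(z - g) = l(1 - f̄z)(1 - ḡz), |l| = 1, of a
Blaschke product; once a single triangle exists, every such fibre is a Poncelet triangle
(`exists_blaschke_parametrization`).

The circumcenter is then a real-affine function of l, so its locus is an ellipse, and one point v
has the same power -κ < 0 with respect to all circumcircles (`exists_constant_power`). Subtracting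
the powers of O and v cancels the quadratic terms in X₃, so the power P of O is an affine function
of X₃.

Inversion acts on the circumcircle as the homothety with centre O and ratio r²/P, so X₃' = O +
(r²/P)(X₃ - O). With the linear form m = P - r² this reads P[X₃'] = r²[X₃] + m(X₃)[O] in homogeneous
coordinates: a single homology with centre O, whose axis m = 0 consists of the X₃ with P = r². At O
itself the affine function P takes the value -|v - O|² - κ < 0, so the eigenvalues on the axis and
at the centre have opposite signs.

All the claims follow. The homology fixes every line through O, hence the tangents from O agree.
Sending the axis to infinity makes it a homothety of negative ratio. If the axis misses the first
locus, the images are homothetic ellipses, and a linear map makes them circles. If P < 0 throughout,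
X₃ and X₃' lie on opposite sides of O, while an ellipse lies on one side of each tangent. -/

open scoped ComplexConjugate

/-! ### Fibres of a Blaschke product with zeros 0, f, g (f', g' stand for the conjugates of f, g).
-/

/-- Vieta's formulas for a pair of vertices: eliminating the third root. -/
theorem chord_relation_of_vieta {F : Type*} [Field F] {f f' g g' z₁ z₂ z₃ : F}
    (h₁ : z₁ + z₂ + z₃ = f + g + z₁ * z₂ * z₃ * (f' * g'))
    (h₂ : z₁ * z₂ + z₁ * z₃ + z₂ * z₃ = f * g + z₁ * z₂ * z₃ * (f' + g')) :
    (f + z₁ * z₂ * f' - (z₁ + z₂)) * (g + z₁ * z₂ * g' - (z₁ + z₂)) =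
      (1 - f * f') * (1 - g * g') * (z₁ * z₂) := by
  linear_combination ((z₁ + z₂) - z₁ * z₂ * (f' + g')) * h₁ - (1 - z₁ * z₂ * f' * g') * h₂

/-- Two chords from the same vertex satisfying the tangency relation. -/
theorem blaschke_of_chord_relations {F : Type*} [Field F] {f f' g g' ρ z₁ z₂ z₃ : F}
    (h : z₂ ≠ z₃)
    (h₂ : (f + z₁ * z₂ * f' - (z₁ + z₂)) * (g + z₁ * z₂ * g' - (z₁ + z₂)) = ρ * (z₁ * z₂))
    (h₃ : (f + z₁ * z₃ * f' - (z₁ + z₃)) * (g + z₁ * z₃ * g' - (z₁ + z₃)) = ρ * (z₁ * z₃)) :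
    z₁ * (z₁ - f) * (z₁ - g) = z₁ * z₂ * z₃ * ((1 - f' * z₁) * (1 - g' * z₁)) := by
  have : z₂ - z₃ ≠ 0 := sub_ne_zero.2 h
  apply mul_left_cancel₀ this
  -- This combination cancels ρ, and the rest is divisible by z₂ - z₃.
  linear_combination z₁ * z₂ * h₃ - z₁ * z₃ * h₂

/-- A triangle all of whose sides satisfy the tangency relation is a fibre of the Blaschke product
with zeros `0`, `f`, `g`. -/
theorem vieta_of_chord_relations {F : Type*} [Field F] {f f' g g' ρ z₁ z₂ z₃ : F}
    (h12 : z₁ ≠ z₂) (h13 : z₁ ≠ z₃) (h23 : z₂ ≠ z₃) (n₁ : z₁ ≠ 0) (n₂ : z₂ ≠ 0)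
    (r12 : (f + z₁ * z₂ * f' - (z₁ + z₂)) * (g + z₁ * z₂ * g' - (z₁ + z₂)) = ρ * (z₁ * z₂))
    (r13 : (f + z₁ * z₃ * f' - (z₁ + z₃)) * (g + z₁ * z₃ * g' - (z₁ + z₃)) = ρ * (z₁ * z₃))
    (r23 : (f + z₂ * z₃ * f' - (z₂ + z₃)) * (g + z₂ * z₃ * g' - (z₂ + z₃)) = ρ * (z₂ * z₃)) :
    z₁ + z₂ + z₃ = f + g + z₁ * z₂ * z₃ * (f' * g') ∧
      z₁ * z₂ + z₁ * z₃ + z₂ * z₃ = f * g + z₁ * z₂ * z₃ * (f' + g') := by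
  have b₁ := blaschke_of_chord_relations h23 r12 r13
  have b₂ := blaschke_of_chord_relations (z₁ := z₂) (z₂ := z₁) (z₃ := z₃) (f := f) (f' := f')
    (g := g) (g' := g') (ρ := ρ) h13 (by linear_combination r12) r23
  set D₁ := f + g + z₁ * z₂ * z₃ * (f' * g') - (z₁ + z₂ + z₃) with hD₁
  set D₂ := f * g + z₁ * z₂ * z₃ * (f' + g') - (z₁ * z₂ + z₁ * z₃ + z₂ * z₃) with hD₂
  -- The Blaschke cubic and the cubic with roots z₁, z₂, z₃ share their leading and constant terms.
  -- Their difference, divided by z, is affine in z; it vanishes at z₁ and z₂, hence identically.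
  have c₁ : D₁ * z₁ = D₂ := by
    apply mul_left_cancel₀ n₁
    rw [hD₁, hD₂]
    linear_combination -b₁
  have c₂ : D₁ * z₂ = D₂ := by
    apply mul_left_cancel₀ n₂
    rw [hD₁, hD₂]
    linear_combination -b₂
  have d₁ : D₁ = 0 := by
    have : D₁ * (z₁ - z₂) = 0 := by linear_combination c₁ - c₂
    exact (mul_eq_zero.1 this).resolve_right (sub_ne_zero.2 h12)
  have d₂ : D₂ = 0 := by rw [← c₁, d₁, zero_mul]
  constructor
  · linear_combination -d₁
  · linear_combination -d₂

theorem exists_roots_of_cubic (e₁ e₂ e₃ : ℂ) : ∃ z₁ z₂ z₃ : ℂ,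
    z₁ + z₂ + z₃ = e₁ ∧ z₁ * z₂ + z₁ * z₃ + z₂ * z₃ = e₂ ∧ z₁ * z₂ * z₃ = e₃ := by
  open Polynomial in
  obtain ⟨z, hz⟩ := IsAlgClosed.exists_root (X ^ 3 - C e₁ * X ^ 2 + C e₂ * X - C e₃ : ℂ[X]) (by
    have : (X ^ 3 - C e₁ * X ^ 2 + C e₂ * X - C e₃ : ℂ[X]).degree = 3 := by compute_degree!
    rw [this]; decide)
  simp only [Polynomial.IsRoot, Polynomial.eval_sub, Polynomial.eval_add, Polynomial.eval_mul,
    Polynomial.eval_pow, Polynomial.eval_X, Polynomial.eval_C] at hz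
  obtain ⟨w, hw⟩ := IsAlgClosed.exists_eq_mul_self ((e₁ - z) ^ 2 - 4 * (e₂ - z * (e₁ - z)))
  refine ⟨z, (e₁ - z + w) / 2, (e₁ - z - w) / 2, by ring, ?_, ?_⟩
  · linear_combination hw / 4
  · linear_combination z * hw / 4 + hz

/-- This identity shows that a Blaschke factor has modulus less than 1 inside the disc and greater
than 1 outside. -/
theorem normSq_one_sub_conj_mul_sub (f z : ℂ) :
    Complex.normSq (1 - conj f * z) - Complex.normSq (z - f) =
      (1 - Complex.normSq z) * (1 - Complex.normSq f) := by
  simp [Complex.normSq_apply]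
  ring

theorem norm_sub_lt_of_norm_lt_one {f z : ℂ} (hf : ‖f‖ < 1) (hz : ‖z‖ < 1) :
    ‖z - f‖ < ‖1 - conj f * z‖ := by
  have h := normSq_one_sub_conj_mul_sub f z
  simp only [Complex.normSq_eq_norm_sq] at h
  have h1 : 0 < (1 - ‖z‖ ^ 2) * (1 - ‖f‖ ^ 2) := by
    apply mul_pos <;> nlinarith [norm_nonneg f, norm_nonneg z]
  exact lt_of_pow_lt_pow_left₀ 2 (norm_nonneg _) (by linarith)

theorem norm_lt_norm_sub_of_one_lt_norm {f z : ℂ} (hf : ‖f‖ < 1) (hz : 1 < ‖z‖) :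
    ‖1 - conj f * z‖ < ‖z - f‖ := by
  have h := normSq_one_sub_conj_mul_sub f z
  simp only [Complex.normSq_eq_norm_sq] at h
  have h1 : 0 < (‖z‖ ^ 2 - 1) * (1 - ‖f‖ ^ 2) := by
    apply mul_pos <;> nlinarith [norm_nonneg f, norm_nonneg z]
  exact lt_of_pow_lt_pow_left₀ 2 (norm_nonneg _) (by linarith)

/-- The fibres of a Blaschke product over points of the unit circle lie on the unit circle. -/
theorem norm_eq_one_of_blaschke {f g z l : ℂ} (hf : ‖f‖ < 1) (hg : ‖g‖ < 1) (hl : ‖l‖ = 1)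
    (h : z * (z - f) * (z - g) = l * ((1 - conj f * z) * (1 - conj g * z))) : ‖z‖ = 1 := by
  have h' := congrArg norm h
  simp only [norm_mul, hl, one_mul] at h'
  rcases lt_trichotomy ‖z‖ 1 with hz | hz | hz
  · have a := norm_sub_lt_of_norm_lt_one hf hz
    have b := norm_sub_lt_of_norm_lt_one hg hz
    have c := mul_lt_mul'' a b (norm_nonneg _) (norm_nonneg _)
    have d : ‖z‖ * (‖z - f‖ * ‖z - g‖) ≤ 1 * (‖z - f‖ * ‖z - g‖) := by gcongr
    linarith
  · exact hz
  · have a := norm_lt_norm_sub_of_one_lt_norm hf hz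
    have b := norm_lt_norm_sub_of_one_lt_norm hg hz
    have c := mul_lt_mul'' a b (norm_nonneg _) (norm_nonneg _)
    have d : 1 * (‖z - f‖ * ‖z - g‖) ≤ ‖z‖ * (‖z - f‖ * ‖z - g‖) := by gcongr
    linarith

theorem mul_conj_eq_one {z : ℂ} (hz : ‖z‖ = 1) : z * conj z = 1 := by
  rw [Complex.mul_conj, Complex.normSq_eq_norm_sq, hz]; simp

theorem ne_zero_of_norm_eq_one {z : ℂ} (hz : ‖z‖ = 1) : z ≠ 0 := by
  rintro rfl; simp at hz

/-- The right side is at least 2(1 - |f|), which exceeds 1 - |f|² by (1 - |f|)². This gap keeps the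
points of a fibre distinct. -/
theorem one_sub_sq_lt_two_re {f z : ℂ} (hf : ‖f‖ < 1) (hz : ‖z‖ = 1) :
    1 - ‖f‖ ^ 2 < 2 * (1 - conj f * z).re := by
  have h1 : (conj f * z).re ≤ ‖f‖ := by
    calc (conj f * z).re ≤ ‖conj f * z‖ := Complex.re_le_norm _
      _ = ‖f‖ := by rw [norm_mul, hz, mul_one, RCLike.norm_conj]
  have h2 : (1 - conj f * z).re = 1 - (conj f * z).re := by simp
  rw [h2]
  nlinarith [norm_nonneg f]

/-- A chord relation with the constant `(1 - |f|²)(1 - |g|²)` cannot degenerate. -/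
theorem ne_of_chord_relation {f g z w : ℂ} (hf : ‖f‖ < 1) (hg : ‖g‖ < 1) (hz : ‖z‖ = 1)
    (h : (f + z * w * conj f - (z + w)) * (g + z * w * conj g - (z + w)) =
      (1 - f * conj f) * (1 - g * conj g) * (z * w)) : z ≠ w := by
  rintro rfl
  have hz' := mul_conj_eq_one hz
  -- When the two endpoints coincide, each factor is -z times a positive real number, so the
  -- relation becomes an equality of reals.
  have key : ∀ f : ℂ, f + z * z * conj f - (z + z) = -z * ((2 * (1 - conj f * z).re : ℝ) : ℂ) := by
    intro f
    have : ((2 * (1 - conj f * z).re : ℝ) : ℂ) = (1 - conj f * z) + conj (1 - conj f * z) := by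
      rw [Complex.add_conj]
    rw [this]
    simp only [map_sub, map_one, map_mul, Complex.conj_conj]
    linear_combination -f * hz'
  rw [key, key, Complex.mul_conj, Complex.mul_conj, Complex.normSq_eq_norm_sq,
    Complex.normSq_eq_norm_sq] at h
  have h2 : ((2 * (1 - conj f * z).re * (2 * (1 - conj g * z).re) : ℝ) : ℂ) =
      (((1 - ‖f‖ ^ 2) * (1 - ‖g‖ ^ 2) : ℝ) : ℂ) := by
    have n : z * z ≠ 0 := mul_ne_zero (ne_zero_of_norm_eq_one hz) (ne_zero_of_norm_eq_one hz)
    apply mul_left_cancel₀ n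
    push_cast at h ⊢
    linear_combination h
  have h3 := Complex.ofReal_injective h2
  have a := one_sub_sq_lt_two_re hf hz
  have b := one_sub_sq_lt_two_re hg hz
  have c := mul_lt_mul'' a b (by nlinarith [norm_nonneg f]) (by nlinarith [norm_nonneg g])
  linarith

/-- Every point `l` of the unit circle has three distinct preimages `z` on the unit circle under the
Blaschke product with zeros `0`, `f`, `g`. -/
theorem exists_blaschke_triangle {f g l : ℂ} (hf : ‖f‖ < 1) (hg : ‖g‖ < 1) (hl : ‖l‖ = 1) :
    ∃ z₁ z₂ z₃ : ℂ, ‖z₁‖ = 1 ∧ ‖z₂‖ = 1 ∧ ‖z₃‖ = 1 ∧ z₁ ≠ z₂ ∧ z₁ ≠ z₃ ∧ z₂ ≠ z₃ ∧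
      z₁ + z₂ + z₃ = f + g + l * (conj f * conj g) ∧
      z₁ * z₂ + z₁ * z₃ + z₂ * z₃ = f * g + l * (conj f + conj g) ∧ z₁ * z₂ * z₃ = l := by
  obtain ⟨z₁, z₂, z₃, h₁, h₂, h₃⟩ := exists_roots_of_cubic (f + g + l * (conj f * conj g))
    (f * g + l * (conj f + conj g)) l
  have root : ∀ z, (z - z₁) * (z - z₂) * (z - z₃) = 0 → ‖z‖ = 1 := fun z hz ↦ by
    apply norm_eq_one_of_blaschke hf hg hl
    linear_combination hz + z ^ 2 * h₁ - z * h₂ + h₃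
  have n₁ := root z₁ (by ring)
  have n₂ := root z₂ (by ring)
  have n₃ := root z₃ (by ring)
  refine ⟨z₁, z₂, z₃, n₁, n₂, n₃, ?_, ?_, ?_, h₁, h₂, h₃⟩
  · exact ne_of_chord_relation hf hg n₁ (chord_relation_of_vieta (z₃ := z₃)
      (by rw [h₃]; exact h₁) (by rw [h₃]; exact h₂))
  · refine ne_of_chord_relation hf hg n₁ (chord_relation_of_vieta (z₃ := z₂) ?_ ?_)
    · linear_combination h₁ - conj f * conj g * h₃
    · linear_combination h₂ - (conj f + conj g) * h₃
  · refine ne_of_chord_relation hf hg n₂ (chord_relation_of_vieta (z₃ := z₁) ?_ ?_)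
    · linear_combination h₁ - conj f * conj g * h₃
    · linear_combination h₂ - (conj f + conj g) * h₃

/-! ### Real affine maps of the plane in the coordinates z, z̄. -/

/-- Every real linear equivalence of `ℂ` is `z ↦ p z + q z̄` with `|p| ≠ |q|`. -/
theorem exists_affineEquiv_coeffs (φ : ℂ ≃ᵃ[ℝ] ℂ) : ∃ p q c : ℂ,
    ‖p‖ ≠ ‖q‖ ∧ ∀ z, φ z = p * z + q * conj z + c := by
  set L := φ.linear
  have hL : ∀ z, φ z = L z + φ 0 := fun z ↦ by
    simpa using φ.map_vadd 0 z
  set p := (L 1 - Complex.I * L Complex.I) / 2 with hp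
  set q := (L 1 + Complex.I * L Complex.I) / 2 with hq
  have hLz : ∀ z, L z = p * z + q * conj z := fun z ↦ by
    have h1 : L z = z.re • L 1 + z.im • L Complex.I := by
      rw [← map_smul, ← map_smul, ← map_add]
      congr 1
      simp
    rw [h1, hp, hq, Complex.real_smul, Complex.real_smul]
    nth_rewrite 3 [← Complex.re_add_im z]
    nth_rewrite 5 [← Complex.re_add_im z]
    simp only [map_add, map_mul, Complex.conj_ofReal, Complex.conj_I]
    linear_combination (z.im * L Complex.I : ℂ) * Complex.I_mul_I
  refine ⟨p, q, φ 0, fun h ↦ ?_, fun z ↦ by rw [hL, hLz]⟩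
  have hpq : p * conj p = q * conj q := by
    rw [Complex.mul_conj, Complex.mul_conj, Complex.normSq_eq_norm_sq, Complex.normSq_eq_norm_sq, h]
  -- If |p| = |q|, the map kills both p̄ - q and i(p̄ + q); injectivity then forces p = q = 0.
  have h1 : L (conj p - q) = 0 := by
    rw [hLz]; simp only [map_sub, Complex.conj_conj]; linear_combination hpq
  have h2 : L (Complex.I * (conj p + q)) = 0 := by
    rw [hLz]; simp only [map_mul, map_add, Complex.conj_conj, Complex.conj_I]
    linear_combination Complex.I * hpq
  rw [LinearEquiv.map_eq_zero_iff] at h1 h2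
  have h3 := (mul_eq_zero.1 h2).resolve_left Complex.I_ne_zero
  have hq0 : q = 0 := by linear_combination (h3 - h1) / 2
  have hp0 : p = 0 := by
    have : conj p = 0 := by linear_combination (h3 + h1) / 2
    simpa using this
  have : L 1 = 0 := by rw [hLz, hp0, hq0]; simp
  rw [LinearEquiv.map_eq_zero_iff] at this
  exact one_ne_zero this

theorem mul_conj_eq_norm_sq (z : ℂ) : z * conj z = ((‖z‖ ^ 2 : ℝ) : ℂ) := by
  rw [Complex.mul_conj, Complex.normSq_eq_norm_sq]

theorem exists_affineEquiv_of_coeffs {a b : ℂ} (h : ‖a‖ ≠ ‖b‖) (c : ℂ) :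
    ∃ φ : ℂ ≃ᵃ[ℝ] ℂ, ∀ z, φ z = a * z + b * conj z + c := by
  have hD : a * conj a - b * conj b ≠ 0 := by
    rw [mul_conj_eq_norm_sq, mul_conj_eq_norm_sq, ← Complex.ofReal_sub]
    norm_cast
    intro h'
    have : ‖a‖ ^ 2 = ‖b‖ ^ 2 := by linarith
    exact h ((sq_eq_sq₀ (norm_nonneg _) (norm_nonneg _)).1 this)
  have hD' : conj (a * conj a - b * conj b) = a * conj a - b * conj b := by
    simp only [map_sub, map_mul, Complex.conj_conj]; ring
  let e : ℂ ≃ₗ[ℝ] ℂ :=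
    { toFun := fun z ↦ a * z + b * conj z
      map_add' := fun z w ↦ by simp only [map_add]; ring
      map_smul' := fun t z ↦ by
        simp only [Complex.real_smul, map_mul, Complex.conj_ofReal, RingHom.id_apply]; ring
      invFun := fun z ↦ (conj a * z - b * conj z) / (a * conj a - b * conj b)
      left_inv := fun z ↦ by
        simp only [map_add, map_mul, Complex.conj_conj]
        rw [div_eq_iff hD]
        ring
      right_inv := fun z ↦ by
        simp only [map_div₀, hD', map_sub, map_mul, Complex.conj_conj]
        field_simp
        ring }
  refine ⟨e.toAffineEquiv.trans (AffineEquiv.constVAdd ℝ ℂ c), fun z ↦ ?_⟩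
  change c + (a * z + b * conj z) = _
  ring

/-! ### Tangency of chords of the unit circle to the inner ellipse. -/

theorem mem_line_iff_exists_lineMap {a b w : ℂ} :
    w ∈ line[ℝ, a, b] ↔ ∃ t : ℝ, AffineMap.lineMap a b t = w := by
  constructor
  · intro h
    have h' : (w - a) +ᵥ a ∈ line[ℝ, a, b] := by simpa using h
    obtain ⟨t, ht⟩ := vadd_left_mem_affineSpan_pair.1 h'
    refine ⟨t, ?_⟩
    rw [AffineMap.lineMap_apply, ht]
    simp
  · rintro ⟨t, rfl⟩
    exact AffineMap.lineMap_mem_affineSpan_pair _ _ _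

theorem conj_eq_inv_of_norm_eq_one {z : ℂ} (hz : ‖z‖ = 1) : conj z = z⁻¹ :=
  eq_inv_of_mul_eq_one_right (mul_conj_eq_one hz)

/-- The chord of the unit circle through `z₁` and `z₂`. -/
theorem mem_line_iff_of_norm_eq_one {z₁ z₂ : ℂ} (h₁ : ‖z₁‖ = 1) (h₂ : ‖z₂‖ = 1) (h : z₁ ≠ z₂)
    (w : ℂ) : w ∈ line[ℝ, z₁, z₂] ↔ w + z₁ * z₂ * conj w = z₁ + z₂ := by
  have n₁ := ne_zero_of_norm_eq_one h₁
  have n₂ := ne_zero_of_norm_eq_one h₂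
  have hs : z₂ - z₁ ≠ 0 := sub_ne_zero.2 h.symm
  have c₁ := mul_conj_eq_one h₁
  have c₂ := mul_conj_eq_one h₂
  constructor
  · intro hw
    obtain ⟨t, rfl⟩ := mem_line_iff_exists_lineMap.1 hw
    simp only [AffineMap.lineMap_apply, vsub_eq_sub, vadd_eq_add, Complex.real_smul, map_add,
      map_mul, map_sub, Complex.conj_ofReal]
    linear_combination (1 - (t : ℂ)) * z₂ * c₁ + t * z₁ * c₂
  · intro hw
    -- The point w lies on the line exactly when this ratio is real.
    have hr : conj ((w - z₁) / (z₂ - z₁)) = (w - z₁) / (z₂ - z₁) := by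
      rw [map_div₀, map_sub, map_sub, conj_eq_inv_of_norm_eq_one h₁,
        conj_eq_inv_of_norm_eq_one h₂]
      have e : conj w = (z₁ + z₂ - w) / (z₁ * z₂) := by
        field_simp
        linear_combination hw
      rw [e, div_eq_div_iff _ hs]
      · field_simp
        ring
      · have : z₂⁻¹ - z₁⁻¹ = (z₁ - z₂) / (z₁ * z₂) := by field_simp
        rw [this]
        exact div_ne_zero (sub_ne_zero.2 h) (mul_ne_zero n₁ n₂)
    obtain ⟨t, ht⟩ := Complex.conj_eq_iff_real.1 hr
    rw [mem_line_iff_exists_lineMap]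
    refine ⟨t, ?_⟩
    rw [AffineMap.lineMap_apply, vsub_eq_sub, vadd_eq_add, Complex.real_smul, ← ht]
    field_simp
    ring

/-- Tangency of the line `α ζ + s ᾱ ζ̄ = γ` to the unit circle. -/
theorem existsUnique_norm_eq_one_iff {α γ s : ℂ} (hs : ‖s‖ = 1) (hα : α ≠ 0)
    (hγ : s * conj γ = γ) :
    (∃! ζ : ℂ, ‖ζ‖ = 1 ∧ α * ζ + s * conj α * conj ζ = γ) ↔ γ ^ 2 = 4 * s * (α * conj α) := by
  have hs' := mul_conj_eq_one hs
  have hα' : conj α ≠ 0 := by simpa using hα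
  constructor
  · rintro ⟨ζ, ⟨hζ, he⟩, hu⟩
    have n := ne_zero_of_norm_eq_one hζ
    have c := mul_conj_eq_one hζ
    have cn := conj_eq_inv_of_norm_eq_one hζ
    -- Multiplied by ζ, the equation is the quadratic αζ² - γζ + sᾱ = 0. The point supplied here is
    -- its other root, also unimodular, so uniqueness forces a double root.
    have := hu (s * conj α * conj ζ / α) ⟨by
        rw [norm_div, norm_mul, norm_mul, RCLike.norm_conj, RCLike.norm_conj, hs, hζ]
        field_simp, by
        simp only [map_div₀, map_mul, Complex.conj_conj]
        field_simp
        linear_combination he + ζ * α * hs'⟩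
    rw [div_eq_iff hα] at this
    rw [← he]
    linear_combination (α * ζ - s * conj α * conj ζ) * (this) * (-1) + 4 * s * α * conj α * c
  · intro hγ2
    have hn : ‖γ / (2 * α)‖ = 1 := by
      have := congrArg norm hγ2
      simp only [norm_pow, norm_mul, hs, RCLike.norm_conj, mul_one, RCLike.norm_ofNat] at this
      have h2 : ‖γ‖ = 2 * ‖α‖ := by
        rw [← sq_eq_sq₀ (norm_nonneg _) (by positivity)]
        linarith
      rw [norm_div, norm_mul, h2, RCLike.norm_ofNat]
      have := norm_pos_iff.2 hα
      field_simp
    refine ⟨γ / (2 * α), ⟨hn, ?_⟩, ?_⟩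
    · simp only [map_div₀, map_mul, map_ofNat]
      field_simp
      linear_combination hγ
    · rintro ζ ⟨hζ, he⟩
      have c := mul_conj_eq_one hζ
      have : (2 * α * ζ - γ) ^ 2 = 0 := by
        linear_combination hγ2 + 4 * α * ζ * he - 4 * α * s * conj α * c
      rw [sq_eq_zero_iff] at this
      field_simp
      linear_combination this

/-- Tangency of a chord of the unit circle to the ellipse `ζ ↦ p ζ + q ζ̄ + c`, whose foci are
`c ± η`. -/
theorem existsUnique_tangent_iff_chord_relation {p q c η : ℂ} (hpq : ‖p‖ ≠ ‖q‖)
    (hη : η ^ 2 = 4 * (p * q)) {z₁ z₂ : ℂ} (h₁ : ‖z₁‖ = 1) (h₂ : ‖z₂‖ = 1) (h : z₁ ≠ z₂) :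
    (∃! ζ : ℂ, ‖ζ‖ = 1 ∧ p * ζ + q * conj ζ + c ∈ line[ℝ, z₁, z₂]) ↔
      (c + η + z₁ * z₂ * conj (c + η) - (z₁ + z₂)) *
          (c - η + z₁ * z₂ * conj (c - η) - (z₁ + z₂)) =
        ((4 * (‖p‖ - ‖q‖) ^ 2 : ℝ) : ℂ) * (z₁ * z₂) := by
  have hs : ‖z₁ * z₂‖ = 1 := by rw [norm_mul, h₁, h₂, one_mul]
  have c₁ := mul_conj_eq_one h₁
  have c₂ := mul_conj_eq_one h₂
  have hs' := mul_conj_eq_one hs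
  have he : z₁ * z₂ * conj (z₁ + z₂) = z₁ + z₂ := by
    rw [map_add]; linear_combination z₂ * c₁ + z₁ * c₂
  set s := z₁ * z₂ with hsdef
  set e := z₁ + z₂
  have hα : p + s * conj q ≠ 0 := fun h0 ↦ hpq <| by
    have : p = -(s * conj q) := by linear_combination h0
    rw [this, norm_neg, norm_mul, hs, RCLike.norm_conj, one_mul]
  have hγ : s * conj (e - c - s * conj c) = e - c - s * conj c := by
    simp only [map_sub, map_mul, Complex.conj_conj] at *
    linear_combination he - c * hs'
  -- Each focal factor is, up to phase, twice the signed distance from a focus to the chord, and the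
  -- semi-minor axis is ||p| - |q||; this gives the constant 4(|p| - |q|)².
  have key := existsUnique_norm_eq_one_iff hs hα hγ
  have hp := mul_conj_eq_norm_sq p
  have hq := mul_conj_eq_norm_sq q
  have hη' : conj η ^ 2 = 4 * (conj p * conj q) := by
    have := congrArg conj hη
    simpa only [map_pow, map_mul, map_ofNat] using this
  have hn : η * conj η = ((4 * (‖p‖ * ‖q‖) : ℝ) : ℂ) := by
    rw [mul_conj_eq_norm_sq, ← norm_pow, hη, norm_mul, norm_mul, RCLike.norm_ofNat]
  have hL : ∀ ζ : ℂ, (‖ζ‖ = 1 ∧ p * ζ + q * conj ζ + c ∈ line[ℝ, z₁, z₂]) ↔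
      (‖ζ‖ = 1 ∧ (p + s * conj q) * ζ + s * conj (p + s * conj q) * conj ζ =
        e - c - s * conj c) := fun ζ ↦ by
    rw [mem_line_iff_of_norm_eq_one h₁ h₂ h]
    simp only [map_add, map_mul, Complex.conj_conj]
    refine and_congr_right fun _ ↦ ⟨fun H ↦ ?_, fun H ↦ ?_⟩
    · linear_combination H + q * conj ζ * hs'
    · linear_combination H - q * conj ζ * hs'
  simp only [hL]
  rw [key]
  push_cast at hp hq hn ⊢
  simp only [map_add, map_sub, map_mul, Complex.conj_conj]
  constructor
  · intro H
    linear_combination H - hη - s ^ 2 * hη' + 4 * s * (hp + hq) - 2 * s * hn +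
      4 * q * (p + s * conj q) * hs'
  · intro H
    linear_combination H + hη + s ^ 2 * hη' - 4 * s * (hp + hq) + 2 * s * hn -
      4 * q * (p + s * conj q) * hs'

/-- The foci of an ellipse contained in the unit disc lie in the disc. -/
theorem norm_focus_lt_one {p q c η : ℂ} (hη : η ^ 2 = 4 * (p * q))
    (hin : ∀ ζ : ℂ, ‖ζ‖ = 1 → ‖p * ζ + q * conj ζ + c‖ < 1) : ‖c + η‖ < 1 := by
  have conv : ∀ (w : ℂ) (t : ℝ), 0 ≤ t → t ≤ 1 → ‖c + w‖ < 1 → ‖c - w‖ < 1 →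
      ‖c + t * w‖ < 1 := fun w t h0 h1 ha hb ↦ by
    have : c + t * w = ((1 + t) / 2 : ℝ) * (c + w) + ((1 - t) / 2 : ℝ) * (c - w) := by
      push_cast; ring
    rw [this]
    calc _ ≤ (1 + t) / 2 * ‖c + w‖ + (1 - t) / 2 * ‖c - w‖ := by
          refine (norm_add_le _ _).trans (le_of_eq ?_)
          rw [norm_mul, norm_mul, Complex.norm_of_nonneg (by linarith),
            Complex.norm_of_nonneg (by linarith)]
      _ < 1 := by nlinarith
  have hsym : ∀ ζ : ℂ, ‖ζ‖ = 1 → ‖c + (p * ζ + q * conj ζ)‖ < 1 ∧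
      ‖c - (p * ζ + q * conj ζ)‖ < 1 := fun ζ hζ ↦ by
    refine ⟨by rw [add_comm]; exact hin ζ hζ, ?_⟩
    have := hin (-ζ) (by rwa [norm_neg])
    rw [map_neg] at this
    convert this using 2
    ring
  by_cases h0 : η = 0
  · have := conv _ 0 le_rfl zero_le_one (hsym 1 (by simp)).1 (hsym 1 (by simp)).2
    simpa [h0] using this
  have hp : p ≠ 0 := by rintro rfl; simp at hη; exact h0 hη
  have hn0 : 0 < ‖η‖ := norm_pos_iff.2 h0
  have hp0 : 0 < ‖p‖ := norm_pos_iff.2 hp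
  have hp' : conj p ≠ 0 := by simpa using hp
  have hnn : ‖η‖ ^ 2 = 4 * (‖p‖ * ‖q‖) := by
    rw [← norm_pow, hη, norm_mul, norm_mul, RCLike.norm_ofNat]
  have hpc := mul_conj_eq_norm_sq p
  have hηc := mul_conj_eq_norm_sq η
  have hηC : (‖η‖ : ℂ) ≠ 0 := by exact_mod_cast hn0.ne'
  have hpC : (‖p‖ : ℂ) ≠ 0 := by exact_mod_cast hp0.ne'
  have hnnC : (‖η‖ : ℂ) ^ 2 = 4 * (‖p‖ * ‖q‖) := by exact_mod_cast hnn
  push_cast at hpc hηc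
  -- This ζ aligns both pζ and qζ̄ with η, so c ± (pζ + qζ̄) are the ends of the major axis. The
  -- focus lies on the segment between them, and the disc is convex.
  set ζ : ℂ := ‖p‖ * η / (‖η‖ * p) with hζ
  have hζ1 : ‖ζ‖ = 1 := by
    rw [hζ, norm_div, norm_mul, norm_mul, Complex.norm_real, Complex.norm_real, norm_norm,
      norm_norm]
    field_simp
  have hw : p * ζ + q * conj ζ = ((‖p‖ + ‖q‖ : ℝ) / ‖η‖ : ℝ) * η := by
    rw [hζ]
    simp only [map_div₀, map_mul, Complex.conj_ofReal]
    push_cast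
    have e1 : q * conj η * ‖p‖ = ‖q‖ * η * conj p := by
      apply mul_left_cancel₀ (mul_ne_zero hp (mul_ne_zero h0 hpC))
      linear_combination ((p * q) * ‖p‖ ^ 2) * hηc + p * q * ‖p‖ ^ 2 * hnnC -
        ‖p‖ * ‖q‖ * η ^ 2 * hpc - ‖p‖ ^ 3 * ‖q‖ * hη
    field_simp
    linear_combination e1
  have hle : ‖η‖ ≤ ‖p‖ + ‖q‖ := by
    rw [← sq_le_sq₀ hn0.le (by positivity), hnn]
    nlinarith [sq_nonneg (‖p‖ - ‖q‖)]
  have hpos : 0 < ‖p‖ + ‖q‖ := by positivity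
  have := conv _ (‖η‖ / (‖p‖ + ‖q‖)) (by positivity) (by rwa [div_le_one hpos])
    (hsym ζ hζ1).1 (hsym ζ hζ1).2
  rw [hw] at this
  convert this using 2
  rw [← mul_assoc, ← Complex.ofReal_mul]
  have : ‖η‖ / (‖p‖ + ‖q‖) * ((‖p‖ + ‖q‖) / ‖η‖) = 1 := by field_simp
  rw [this]
  simp

/-! ### Poncelet triangles as Blaschke fibres. -/

theorem mem_ellipse_apply {A : ℂ ≃ᵃ[ℝ] ℂ} {z : ℂ} : A z ∈ ellipse A ↔ ‖z‖ = 1 := by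
  rw [ellipse, A.injective.mem_set_image, mem_sphere_zero_iff_norm]

/-- Transport of the tangency condition to the chart in which the outer ellipse is the unit
circle. -/
theorem existsUnique_mem_ellipse_iff (A B : ℂ ≃ᵃ[ℝ] ℂ) (z₁ z₂ : ℂ) :
    (∃! P : ℂ, P ∈ ellipse B ∧ P ∈ line[ℝ, A z₁, A z₂]) ↔
      ∃! ζ : ℂ, ‖ζ‖ = 1 ∧ A.symm (B ζ) ∈ line[ℝ, z₁, z₂] := by
  rw [B.bijective.existsUnique_iff]
  refine existsUnique_congr fun ζ ↦ and_congr mem_ellipse_apply ?_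
  simp only [mem_line_iff_exists_lineMap]
  refine exists_congr fun t ↦ ?_
  rw [← A.apply_lineMap, AffineEquiv.eq_symm_apply]

theorem triangle_affineSpan_eq_top (T : Affine.Triangle ℝ ℂ) :
    affineSpan ℝ (Set.range T.points) = ⊤ :=
  T.independent.affineSpan_eq_top_iff_card_eq_finrank_add_one.2 (by
    simp [Complex.finrank_real_complex])

theorem circumcenter_eq_of_norm_sq {T : Affine.Triangle ℝ ℂ} {X : ℂ} {ρ : ℝ}
    (h : ∀ i, ‖T.points i - X‖ ^ 2 = ρ) : T.circumcenter = X ∧ T.circumradius ^ 2 = ρ := by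
  have hd : ∀ i, dist (T.points i) X = √ρ := fun i ↦ by
    rw [dist_eq_norm, ← h i, Real.sqrt_sq (norm_nonneg _)]
  have hX : X = T.circumcenter := by
    apply T.eq_circumcenter_of_dist_eq _ hd
    rw [triangle_affineSpan_eq_top]
    trivial
  refine ⟨hX.symm, ?_⟩
  rw [← h 0, hX, ← dist_eq_norm, T.dist_circumcenter_eq_circumradius]

/-- Coefficients of the outer ellipse of a non-circular pair. -/
theorem coeffs_ne_zero_of_not_circle {A : ℂ ≃ᵃ[ℝ] ℂ} {p q c : ℂ}
    (hA : ∀ z, A z = p * z + q * conj z + c)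
    (hpq : ‖p‖ ≠ ‖q‖) (hnc : ¬ ∃ (c : ℂ) (ρ : ℝ), ellipse A = Metric.sphere c ρ) :
    p ≠ 0 ∧ q ≠ 0 := by
  have surj : ∀ w, ∃ z, A z = w := A.surjective
  constructor
  · rintro rfl
    refine hnc ⟨c, ‖q‖, ?_⟩
    ext w
    obtain ⟨z, rfl⟩ := surj w
    rw [mem_ellipse_apply, mem_sphere_iff_norm, hA]
    have : ‖q‖ ≠ 0 := fun h ↦ hpq (by simp [h])
    simp [this]
  · rintro rfl
    refine hnc ⟨c, ‖p‖, ?_⟩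
    ext w
    obtain ⟨z, rfl⟩ := surj w
    rw [mem_ellipse_apply, mem_sphere_iff_norm, hA]
    have : ‖p‖ ≠ 0 := fun h ↦ hpq (by simp [h])
    simp [this]

/-- The triangles inscribed in the unit circle which form the fibres of the Blaschke product with
zeros `0`, `f`, `g`, described by their elementary symmetric functions. -/
def IsBlaschkeTriangle (f g l : ℂ) (z : Fin 3 → ℂ) : Prop :=
  (∀ i, ‖z i‖ = 1) ∧ z 0 + z 1 + z 2 = f + g + l * (conj f * conj g) ∧
    z 0 * z 1 + z 0 * z 2 + z 1 * z 2 = f * g + l * (conj f + conj g) ∧ z 0 * z 1 * z 2 = l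

theorem IsBlaschkeTriangle.norm_eq_one {f g l : ℂ} {z : Fin 3 → ℂ}
    (h : IsBlaschkeTriangle f g l z) : ‖l‖ = 1 := by
  rw [← h.2.2.2, norm_mul, norm_mul, h.1, h.1, h.1]; norm_num

theorem IsBlaschkeTriangle.root {f g l : ℂ} {z : Fin 3 → ℂ}
    (h : IsBlaschkeTriangle f g l z) (i : Fin 3) :
    z i ^ 3 - (f + g + l * (conj f * conj g)) * z i ^ 2 + (f * g + l * (conj f + conj g)) * z i
      - l = 0 := by
  obtain ⟨-, h₁, h₂, h₃⟩ := h
  rw [← h₁, ← h₂]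
  fin_cases i <;> simp only [Fin.zero_eta, Fin.mk_one, Fin.reduceFinMk] <;>
    linear_combination h₃

theorem IsBlaschkeTriangle.chord_relation {f g l : ℂ} {z : Fin 3 → ℂ}
    (h : IsBlaschkeTriangle f g l z) {i j : Fin 3} (hij : i ≠ j) :
    (f + z i * z j * conj f - (z i + z j)) * (g + z i * z j * conj g - (z i + z j)) =
      (1 - f * conj f) * (1 - g * conj g) * (z i * z j) := by
  obtain ⟨-, h₁, h₂, h₃⟩ := h
  have h01 := chord_relation_of_vieta (z₁ := z 0) (z₂ := z 1) (z₃ := z 2) (f := f) (g := g)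
    (f' := conj f) (g' := conj g) (by linear_combination h₁ - conj f * conj g * h₃)
    (by linear_combination h₂ - (conj f + conj g) * h₃)
  have h02 := chord_relation_of_vieta (z₁ := z 0) (z₂ := z 2) (z₃ := z 1) (f := f) (g := g)
    (f' := conj f) (g' := conj g) (by linear_combination h₁ - conj f * conj g * h₃)
    (by linear_combination h₂ - (conj f + conj g) * h₃)
  have h12 := chord_relation_of_vieta (z₁ := z 1) (z₂ := z 2) (z₃ := z 0) (f := f) (g := g)
    (f' := conj f) (g' := conj g) (by linear_combination h₁ - conj f * conj g * h₃)
    (by linear_combination h₂ - (conj f + conj g) * h₃)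
  fin_cases i <;> fin_cases j <;>
    simp only [Fin.zero_eta, Fin.mk_one, Fin.reduceFinMk, ne_eq, not_true_eq_false] at hij ⊢
  · exact h01
  · exact h02
  · linear_combination h01
  · exact h12
  · linear_combination h02
  · linear_combination h12

/-- The parametrization of a Poncelet family of triangles by the fibres of a Blaschke product. -/
theorem exists_blaschke_parametrization (A B : ℂ ≃ᵃ[ℝ] ℂ) (hnested : ellipse B ⊆ ellipseInside A)
    (hfamily : ∃ T : Affine.Triangle ℝ ℂ, IsPonceletTriangle A B T) :
    ∃ f g : ℂ, ‖f‖ < 1 ∧ ‖g‖ < 1 ∧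
      (∀ T, IsPonceletTriangle A B T → ∃ l z, IsBlaschkeTriangle f g l z ∧
        ∀ i, T.points i = A (z i)) ∧
      ∀ l : ℂ, ‖l‖ = 1 → ∃ T z, IsPonceletTriangle A B T ∧ IsBlaschkeTriangle f g l z ∧
        ∀ i, T.points i = A (z i) := by
  obtain ⟨p, q, c, hpq, hB⟩ := exists_affineEquiv_coeffs (B.trans A.symm)
  simp only [AffineEquiv.trans_apply] at hB
  obtain ⟨η, hη⟩ := IsAlgClosed.exists_pow_nat_eq (4 * (p * q)) (n := 2) two_pos
  have hin : ∀ ζ : ℂ, ‖ζ‖ = 1 → ‖p * ζ + q * conj ζ + c‖ < 1 := fun ζ hζ ↦ by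
    obtain ⟨w, hw, hw'⟩ := hnested (mem_ellipse_apply.2 hζ : B ζ ∈ ellipse B)
    rw [← hB, ← hw', AffineEquiv.symm_apply_apply]
    simpa using hw
  have hf : ‖c + η‖ < 1 := norm_focus_lt_one hη hin
  have hg : ‖c - η‖ < 1 := by
    rw [sub_eq_add_neg]; exact norm_focus_lt_one (by rwa [neg_sq]) hin
  set ρ : ℂ := ((4 * (‖p‖ - ‖q‖) ^ 2 : ℝ) : ℂ)
  have tangent : ∀ z₁ z₂ : ℂ, ‖z₁‖ = 1 → ‖z₂‖ = 1 → z₁ ≠ z₂ →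
      ((∃! P : ℂ, P ∈ ellipse B ∧ P ∈ line[ℝ, A z₁, A z₂]) ↔
        (c + η + z₁ * z₂ * conj (c + η) - (z₁ + z₂)) *
          (c - η + z₁ * z₂ * conj (c - η) - (z₁ + z₂)) = ρ * (z₁ * z₂)) :=
    fun z₁ z₂ h₁ h₂ h ↦ by
      rw [existsUnique_mem_ellipse_iff]
      simp only [hB]
      exact existsUnique_tangent_iff_chord_relation hpq hη h₁ h₂ h
  set f := c + η
  set g := c - η
  have forward : ∀ T, IsPonceletTriangle A B T → ∃ l z, IsBlaschkeTriangle f g l z ∧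
      (∀ i, T.points i = A (z i)) ∧ ρ = (1 - f * conj f) * (1 - g * conj g) := fun T hT ↦ by
    set z : Fin 3 → ℂ := fun i ↦ A.symm (T.points i) with hz
    have hTz : ∀ i, T.points i = A (z i) := fun i ↦ by simp [hz]
    have hz1 : ∀ i, ‖z i‖ = 1 := fun i ↦ mem_ellipse_apply.1 (hTz i ▸ hT.1 i)
    have hne : ∀ i j, i ≠ j → z i ≠ z j := fun i j hij h ↦
      hij (T.independent.injective (by rw [hTz, hTz, h]))
    have hrel := fun i j (hij : i ≠ j) ↦ (tangent (z i) (z j) (hz1 i) (hz1 j) (hne i j hij)).1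
      (by rw [← hTz, ← hTz]; exact hT.2 i j hij)
    obtain ⟨v₁, v₂⟩ := vieta_of_chord_relations (hne 0 1 (by decide)) (hne 0 2 (by decide))
      (hne 1 2 (by decide)) (ne_zero_of_norm_eq_one (hz1 0)) (ne_zero_of_norm_eq_one (hz1 1))
      (hrel 0 1 (by decide)) (hrel 0 2 (by decide)) (hrel 1 2 (by decide))
    have hbl : IsBlaschkeTriangle f g _ z := ⟨hz1, v₁, v₂, rfl⟩
    refine ⟨_, z, hbl, hTz, ?_⟩
    -- Comparing the tangency constant with that of the fibre gives the closure condition ρ = (1 -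
    -- |f|²)(1 - |g|²).
    have := (hrel 0 1 (by decide)).symm.trans (hbl.chord_relation (by decide))
    exact mul_right_cancel₀ (mul_ne_zero (ne_zero_of_norm_eq_one (hz1 0))
      (ne_zero_of_norm_eq_one (hz1 1))) this
  refine ⟨f, g, hf, hg, fun T hT ↦ ?_, fun l hl ↦ ?_⟩
  · obtain ⟨l, z, h₁, h₂, -⟩ := forward T hT
    exact ⟨l, z, h₁, h₂⟩
  -- Poncelet closure: the condition on ρ does not involve the triangle, so one triangle gives all
  -- of them.
  · obtain ⟨T₀, hT₀⟩ := hfamily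
    obtain ⟨-, -, -, -, hρ⟩ := forward T₀ hT₀
    obtain ⟨z₁, z₂, z₃, n₁, n₂, n₃, h12, h13, h23, v₁, v₂, v₃⟩ := exists_blaschke_triangle hf hg hl
    set z : Fin 3 → ℂ := ![z₁, z₂, z₃] with hz
    have hz1 : ∀ i, ‖z i‖ = 1 := by
      intro i; fin_cases i
      exacts [n₁, n₂, n₃]
    have hbl : IsBlaschkeTriangle f g l z := ⟨hz1, v₁, v₂, v₃⟩
    have hind : AffineIndependent ℝ z :=
      EuclideanGeometry.Cospherical.affineIndependent_of_mem_of_ne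
        (s := Metric.sphere (0 : ℂ) 1) ⟨0, 1, fun _ h ↦ h⟩ (by simpa using n₁) (by simpa using n₂)
        (by simpa using n₃) h12 h13 h23
    let T : Affine.Triangle ℝ ℂ := ⟨A ∘ z, hind.map' A.toAffineMap A.injective⟩
    refine ⟨T, z, ⟨fun i ↦ mem_ellipse_apply.2 (hz1 i), fun i j hij ↦ ?_⟩, hbl, fun i ↦ rfl⟩
    refine (tangent (z i) (z j) (hz1 i) (hz1 j) (hind.injective.ne hij)).2 ?_
    rw [hρ]
    exact hbl.chord_relation hij

/-! ### Circumcircles of the family and the point of constant power. -/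

theorem norm_sq_sub (a b : ℂ) :
    ((‖a - b‖ ^ 2 : ℝ) : ℂ) = a * conj a - (a * conj b + b * conj a) + b * conj b := by
  rw [← mul_conj_eq_norm_sq, map_sub]; ring

/-- The equation of the circumcircle of the image of a Blaschke triangle under
`z ↦ p z + q z̄`. -/
theorem norm_sub_sq_of_root {p q f g l z X : ℂ} (hz : ‖z‖ = 1) (hl : ‖l‖ = 1)
    (hroot : z ^ 3 - (f + g + l * (conj f * conj g)) * z ^ 2 + (f * g + l * (conj f + conj g)) * z
      - l = 0)
    (hX : p * conj X + conj q * X =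
      p * conj q * (f + g + l * (conj f * conj g)) + conj p * q * conj l) :
    ‖p * z + q * conj z - X‖ ^ 2 = ‖X‖ ^ 2 + ‖p‖ ^ 2 + ‖q‖ ^ 2 -
      2 * (p * conj q * (f * g + l * (conj f + conj g))).re := by
  have hz' := mul_conj_eq_one hz
  have hl' := mul_conj_eq_one hl
  have nz := ne_zero_of_norm_eq_one hz
  -- Dividing the cubic by z expresses z² linearly in z and z̄. Then |pz + qz̄ - X|² is also affine
  -- in z, z̄, and `hX` says exactly that the coefficient of z vanishes.
  have hroot' : z ^ 2 - (f + g + l * (conj f * conj g)) * z + (f * g + l * (conj f + conj g))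
      - l * conj z = 0 := by
    apply mul_left_cancel₀ nz
    linear_combination hroot - l * hz'
  have hrootc := congrArg conj hroot'
  have hXc := congrArg conj hX
  have hre : ((2 * (p * conj q * (f * g + l * (conj f + conj g))).re : ℝ) : ℂ) =
      p * conj q * (f * g + l * (conj f + conj g)) +
        conj (p * conj q * (f * g + l * (conj f + conj g))) := (Complex.add_conj _).symm
  apply Complex.ofReal_injective
  rw [norm_sq_sub]
  rw [Complex.ofReal_sub, hre, Complex.ofReal_add, Complex.ofReal_add, ← mul_conj_eq_norm_sq,
    ← mul_conj_eq_norm_sq, ← mul_conj_eq_norm_sq]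
  simp only [map_add, map_sub, map_mul, map_pow, Complex.conj_conj, map_zero] at hrootc hXc ⊢
  linear_combination p * conj q * hroot' + conj p * q * hrootc - z * hX - conj z * hXc +
    (p * conj p + q * conj q) * hz'

/-- The point of constant power. -/
theorem power_of_stationary_point {p q f g l ξ X : ℂ}
    (hX : p * conj X + conj q * X =
      p * conj q * (f + g + l * (conj f * conj g)) + conj p * q * conj l)
    (hξ : ξ + conj ξ * (f * g) = f + g) :
    ‖p * ξ + q * conj ξ - X‖ ^ 2 - (‖X‖ ^ 2 + ‖p‖ ^ 2 + ‖q‖ ^ 2 -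
      2 * (p * conj q * (f * g + l * (conj f + conj g))).re) =
    -((1 - ‖ξ‖ ^ 2) * (‖p‖ ^ 2 + ‖q‖ ^ 2 - 2 * (p * conj q * (f * g)).re)) := by
  have hXc := congrArg conj hX
  have hξc := congrArg conj hξ
  have hre : ((2 * (p * conj q * (f * g + l * (conj f + conj g))).re : ℝ) : ℂ) =
      p * conj q * (f * g + l * (conj f + conj g)) +
        conj (p * conj q * (f * g + l * (conj f + conj g))) := (Complex.add_conj _).symm
  have hre' : ((2 * (p * conj q * (f * g)).re : ℝ) : ℂ) =
      p * conj q * (f * g) + conj (p * conj q * (f * g)) := (Complex.add_conj _).symm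
  apply Complex.ofReal_injective
  rw [Complex.ofReal_sub, norm_sq_sub, Complex.ofReal_sub, hre, Complex.ofReal_add,
    Complex.ofReal_add, Complex.ofReal_neg, Complex.ofReal_mul, Complex.ofReal_sub,
    Complex.ofReal_sub, hre', Complex.ofReal_add, ← mul_conj_eq_norm_sq,
    ← mul_conj_eq_norm_sq, ← mul_conj_eq_norm_sq, ← mul_conj_eq_norm_sq]
  simp only [map_add, map_mul, Complex.conj_conj, Complex.ofReal_one] at hξc hXc ⊢
  -- The parameter l enters only through l(ξ̄ + ξ f̄ḡ - f̄ - ḡ) and its conjugate, which `hξ`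
  -- annihilates.
  linear_combination -ξ * hX - conj ξ * hXc + p * conj q * ξ * hξ + conj p * q * conj ξ * hξc -
    p * conj q * l * hξc - conj p * q * conj l * hξ

/-- Since |fg| < 1, the equation and its conjugate can be solved for ξ. The bound |ξ| < 1, which
makes the constant power negative, reduces to (1 - |f|)(1 - |g|) > 0. -/
theorem exists_stationary_point {f g : ℂ} (hf : ‖f‖ < 1) (hg : ‖g‖ < 1) :
    ∃ ξ : ℂ, ‖ξ‖ < 1 ∧ ξ + conj ξ * (f * g) = f + g := by
  have hF : ‖f * g‖ < 1 := by rw [norm_mul]; nlinarith [norm_nonneg f, norm_nonneg g]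
  have hD : 0 < 1 - ‖f * g‖ ^ 2 := by nlinarith [norm_nonneg (f * g)]
  have hDC : ((1 - ‖f * g‖ ^ 2 : ℝ) : ℂ) ≠ 0 := by exact_mod_cast hD.ne'
  have hDF : ((1 - ‖f * g‖ ^ 2 : ℝ) : ℂ) = 1 - f * g * conj (f * g) := by
    rw [mul_conj_eq_norm_sq]; push_cast; ring
  refine ⟨(f + g - f * g * conj (f + g)) / (1 - ‖f * g‖ ^ 2 : ℝ), ?_, ?_⟩
  · rw [norm_div, Complex.norm_of_nonneg hD.le, div_lt_one hD]
    have e : f + g - f * g * conj (f + g) = f * (1 - ‖g‖ ^ 2 : ℝ) + g * (1 - ‖f‖ ^ 2 : ℝ) := by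
      rw [Complex.ofReal_sub, Complex.ofReal_sub, ← mul_conj_eq_norm_sq, ← mul_conj_eq_norm_sq,
        map_add, Complex.ofReal_one]
      ring
    have hf0 : 0 ≤ 1 - ‖f‖ ^ 2 := by nlinarith [norm_nonneg f]
    have hg0 : 0 ≤ 1 - ‖g‖ ^ 2 := by nlinarith [norm_nonneg g]
    rw [e, norm_mul f g]
    refine (norm_add_le _ _).trans_lt ?_
    rw [norm_mul, norm_mul, Complex.norm_of_nonneg hg0, Complex.norm_of_nonneg hf0]
    have h1 : 0 < (1 - ‖f‖) * (1 - ‖g‖) := mul_pos (by linarith) (by linarith)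
    have h2 : 0 < 1 - ‖f‖ * ‖g‖ := by rw [← norm_mul]; linarith
    nlinarith [mul_pos h1 h2]
  · rw [map_div₀, Complex.conj_ofReal]
    field_simp
    rw [hDF]
    simp only [map_sub, map_add, map_mul, Complex.conj_conj]
    ring

/-- The circumcircles of a Poncelet family all give the same negative power to a certain point, and
the locus of their centres is an ellipse. -/
theorem exists_constant_power (A B : ℂ ≃ᵃ[ℝ] ℂ) (hnested : ellipse B ⊆ ellipseInside A)
    (hnoncircular : ¬ ∃ (c : ℂ) (ρ : ℝ), ellipse A = Metric.sphere c ρ)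
    (hfamily : ∃ T : Affine.Triangle ℝ ℂ, IsPonceletTriangle A B T) :
    ∃ (G : ℂ ≃ᵃ[ℝ] ℂ) (v : ℂ) (κ : ℝ), 0 < κ ∧ circumLocus A B = ellipse G ∧
      ∀ T, IsPonceletTriangle A B T → T.circumsphere.power v = -κ := by
  obtain ⟨p, q, c, hpq, hA⟩ := exists_affineEquiv_coeffs A
  obtain ⟨hp, hq⟩ := coeffs_ne_zero_of_not_circle hA hpq hnoncircular
  obtain ⟨f, g, hf, hg, hT, hT'⟩ := exists_blaschke_parametrization A B hnested hfamily
  obtain ⟨ξ, hξ, hξ'⟩ := exists_stationary_point hf hg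
  have hF : ‖f * g‖ < 1 := by rw [norm_mul]; nlinarith [norm_nonneg f, norm_nonneg g]
  have hD : ‖p‖ ^ 2 - ‖q‖ ^ 2 ≠ 0 := fun h ↦
    hpq ((sq_eq_sq₀ (norm_nonneg _) (norm_nonneg _)).1 (by linarith))
  have hDC : ((‖p‖ ^ 2 - ‖q‖ ^ 2 : ℝ) : ℂ) ≠ 0 := by exact_mod_cast hD
  have hDe : ((‖p‖ ^ 2 - ‖q‖ ^ 2 : ℝ) : ℂ) = p * conj p - q * conj q := by
    rw [mul_conj_eq_norm_sq, mul_conj_eq_norm_sq]; push_cast; ring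
  set D : ℂ := ((‖p‖ ^ 2 - ‖q‖ ^ 2 : ℝ) : ℂ) with hDdef
  have hDc : conj D = D := Complex.conj_ofReal _
  -- the centre of the circumcircle as a function of the parameter
  have hab : ‖(p * (p * conj q) - q * (p * conj q) * (conj f * conj g)) / D‖ ≠
      ‖(p * (conj p * q) * (f * g) - q * (conj p * q)) / D‖ := by
    have e1 : (p * (p * conj q) - q * (p * conj q) * (conj f * conj g)) / D =
        (p * conj q / D) * (p - q * conj (f * g)) := by rw [map_mul]; ring
    have e2 : (p * (conj p * q) * (f * g) - q * (conj p * q)) / D =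
        (conj p * q / D) * (p * (f * g) - q) := by ring
    rw [e1, e2, norm_mul, norm_mul]
    have e3 : ‖p * conj q / D‖ = ‖conj p * q / D‖ := by
      simp
    have e4 : ‖conj p * q / D‖ ≠ 0 := by
      simp [hp, hq, hDC]
    rw [e3]
    intro h
    have h' := mul_left_cancel₀ e4 h
    -- The difference of the squared norms |p - q·conj(fg)|² and |p·fg - q|² is this product,
    -- neither factor of which vanishes.
    have h2 : (((1 - ‖f * g‖ ^ 2) * (‖p‖ ^ 2 - ‖q‖ ^ 2) : ℝ) : ℂ) = 0 := by
      have h3 := congrArg (fun x : ℝ ↦ ((x ^ 2 : ℝ) : ℂ)) h'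
      simp only [norm_sq_sub] at h3
      simp only [map_mul, Complex.conj_conj] at h3
      rw [Complex.ofReal_mul, ← hDdef, hDe, Complex.ofReal_sub, ← mul_conj_eq_norm_sq]
      simp only [map_mul, Complex.ofReal_one]
      linear_combination h3
    rw [Complex.ofReal_eq_zero] at h2
    rcases mul_eq_zero.1 h2 with h4 | h4
    · nlinarith [norm_nonneg (f * g)]
    · exact hD h4
  obtain ⟨G, hG⟩ := exists_affineEquiv_of_coeffs hab
    (c + (p * (conj p * q) * (conj f + conj g) - q * (p * conj q) * (f + g)) / D)
  -- The equation for the centre and its conjugate form a linear system in X and X̄ with determinant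
  -- |p|² - |q|²; `G` is its solution.
  have hGeq : ∀ l, p * conj (G l - c) + conj q * (G l - c) =
      p * conj q * (f + g + l * (conj f * conj g)) + conj p * q * conj l := fun l ↦ by
    rw [hG]
    simp only [map_add, map_sub, map_mul, map_div₀, hDc, Complex.conj_conj]
    field_simp
    rw [hDe]
    ring
  have vert : ∀ (l : ℂ) (z : Fin 3 → ℂ) (T : Affine.Triangle ℝ ℂ), IsBlaschkeTriangle f g l z → (∀ i, T.points i = A (z i)) →
      T.circumcenter = G l ∧ T.circumradius ^ 2 = ‖G l - c‖ ^ 2 + ‖p‖ ^ 2 + ‖q‖ ^ 2 -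
        2 * (p * conj q * (f * g + l * (conj f + conj g))).re := fun l z T hz hTz ↦ by
    apply circumcenter_eq_of_norm_sq
    intro i
    rw [← norm_sub_sq_of_root (hz.1 i) hz.norm_eq_one (hz.root i) (hGeq l), hTz, hA]
    congr 2
    ring
  refine ⟨G, p * ξ + q * conj ξ + c,
    (1 - ‖ξ‖ ^ 2) * (‖p‖ ^ 2 + ‖q‖ ^ 2 - 2 * (p * conj q * (f * g)).re), ?_, ?_, ?_⟩
  · have h1 : (p * conj q * (f * g)).re ≤ ‖p‖ * ‖q‖ * ‖f * g‖ := by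
      refine (Complex.re_le_norm _).trans (le_of_eq ?_)
      rw [norm_mul, norm_mul p, RCLike.norm_conj]
    have h2 : 0 < ‖p‖ * ‖q‖ := mul_pos (norm_pos_iff.2 hp) (norm_pos_iff.2 hq)
    refine mul_pos (by nlinarith [norm_nonneg ξ]) ?_
    nlinarith [sq_nonneg (‖p‖ - ‖q‖)]
  · ext X
    constructor
    · rintro ⟨T, hP, rfl⟩
      obtain ⟨l, z, hz, hTz⟩ := hT T hP
      rw [(vert l z T hz hTz).1]
      exact mem_ellipse_apply.2 hz.norm_eq_one
    · rintro ⟨l, hl, rfl⟩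
      obtain ⟨T, z, hP, hz, hTz⟩ := hT' l (by simpa using hl)
      exact ⟨T, hP, (vert l z T hz hTz).1.symm⟩
  · intro T hP
    obtain ⟨l, z, hz, hTz⟩ := hT T hP
    obtain ⟨h1, h2⟩ := vert l z T hz hTz
    rw [EuclideanGeometry.Sphere.power, Affine.Simplex.circumsphere_center,
      Affine.Simplex.circumsphere_radius, h1, h2, dist_eq_norm,
      ← power_of_stationary_point (hGeq l) hξ']
    congr 3
    ring_nf

/-! ### The inversive triangle and its circumcenter. -/

theorem triangle_norm_sub_sq (T : Affine.Triangle ℝ ℂ) (O : ℂ) (i : Fin 3) :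
    2 * inner ℝ (T.points i - O) (T.circumcenter - O) =
      ‖T.points i - O‖ ^ 2 + T.circumsphere.power O := by
  have h := T.dist_circumcenter_eq_circumradius i
  rw [dist_eq_norm] at h
  rw [EuclideanGeometry.Sphere.power, Affine.Simplex.circumsphere_center,
    Affine.Simplex.circumsphere_radius, ← h, dist_comm, dist_eq_norm]
  have e : T.points i - T.circumcenter = (T.points i - O) - (T.circumcenter - O) := by ring
  rw [e, norm_sub_sq_real (T.points i - O)]
  ring

theorem inversion_sub_center (O : ℂ) (r : ℝ) (w : ℂ) :
    EuclideanGeometry.inversion O r w - O = (r / ‖w - O‖) ^ 2 • (w - O) := by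
  simp [EuclideanGeometry.inversion, dist_eq_norm]

/-- The inverse of a vertex is on the circle centred at `O + (r² / P) (X - O)`. -/
theorem norm_inversion_sub_sq {T : Affine.Triangle ℝ ℂ} {O : ℂ} {r : ℝ} {i : Fin 3}
    (hi : T.points i ≠ O) (hP : T.circumsphere.power O ≠ 0) :
    ‖EuclideanGeometry.inversion O r (T.points i) -
        (O + (r ^ 2 / T.circumsphere.power O) • (T.circumcenter - O))‖ ^ 2 =
      (r ^ 2 / T.circumsphere.power O) ^ 2 * ‖T.circumcenter - O‖ ^ 2 -
        (r ^ 2 / T.circumsphere.power O) * r ^ 2 := by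
  have h := triangle_norm_sub_sq T O i
  have hn : ‖T.points i - O‖ ≠ 0 := norm_ne_zero_iff.2 (sub_ne_zero.2 hi)
  rw [← sub_sub, inversion_sub_center, norm_sub_sq_real, norm_smul, norm_smul, inner_smul_left,
    inner_smul_right, mul_pow, mul_pow, Real.norm_eq_abs, Real.norm_eq_abs, sq_abs, sq_abs]
  simp only [conj_trivial]
  generalize inner ℝ (T.points i - O) (T.circumcenter - O) = a at h ⊢
  generalize ‖T.points i - O‖ = n at *
  generalize T.circumsphere.power O = P at *
  obtain rfl : a = (n ^ 2 + P) / 2 := by linarith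
  field_simp
  ring

/-- If O had power 0, the inverse vertices would satisfy ⟨y - O, X - O⟩ = r²/2. They span the plane,
so y = O would satisfy it too, which is absurd. -/
theorem IsInversiveTriangle.power_ne_zero {T T' : Affine.Triangle ℝ ℂ} {O : ℂ} {r : ℝ} (hr : 0 < r)
    (h : IsInversiveTriangle O r T T') : T.circumsphere.power O ≠ 0 := by
  intro hP
  have key : ∀ y : ℂ, inner ℝ (y - O) (T.circumcenter - O) = r ^ 2 / 2 := by
    intro y
    have hy : y ∈ affineSpan ℝ (Set.range T'.points) := by
      rw [triangle_affineSpan_eq_top]; trivial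
    refine affineSpan_induction hy ?_ ?_
    · rintro _ ⟨i, rfl⟩
      obtain ⟨hi, hi'⟩ := h i
      have hn : ‖T.points i - O‖ ≠ 0 := norm_ne_zero_iff.2 (sub_ne_zero.2 hi)
      have h2 := triangle_norm_sub_sq T O i
      rw [hi', inversion_sub_center, inner_smul_left]
      simp only [conj_trivial]
      have : inner ℝ (T.points i - O) (T.circumcenter - O) = ‖T.points i - O‖ ^ 2 / 2 := by
        linarith
      rw [this]
      field_simp
    · intro c u v w hu hv hw
      have : (c • (u -ᵥ v) +ᵥ w) - O = c • ((u - O) - (v - O)) + (w - O) := by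
        simp only [vsub_eq_sub, vadd_eq_add]
        rw [sub_sub_sub_cancel_right, add_sub_assoc]
      rw [this, inner_add_left, inner_smul_left, inner_sub_left, hu, hv, hw]
      simp
  have := key O
  rw [sub_self, inner_zero_left] at this
  have := pow_pos hr 2
  linarith

theorem IsInversiveTriangle.circumcenter_eq {T T' : Affine.Triangle ℝ ℂ} {O : ℂ} {r : ℝ}
    (hr : 0 < r) (h : IsInversiveTriangle O r T T') :
    T'.circumcenter = O + (r ^ 2 / T.circumsphere.power O) • (T.circumcenter - O) := by
  refine (circumcenter_eq_of_norm_sq (ρ := (r ^ 2 / T.circumsphere.power O) ^ 2 * ‖T.circumcenter - O‖ ^ 2 -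
      (r ^ 2 / T.circumsphere.power O) * r ^ 2) fun i ↦ ?_).1
  rw [(h i).2]
  exact norm_inversion_sub_sq (h i).1 (h.power_ne_zero hr)

/-- The inverse vertices are distinct points of one circle, hence not collinear. -/
theorem exists_isInversiveTriangle {T : Affine.Triangle ℝ ℂ} {O : ℂ} {r : ℝ} (hr : 0 < r)
    (hP : T.circumsphere.power O ≠ 0) : ∃ T', IsInversiveTriangle O r T T' := by
  have hne : ∀ i, T.points i ≠ O := fun i hi ↦ hP <| by
    have := triangle_norm_sub_sq T O i
    rw [hi] at this
    simpa using this.symm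
  have hind : AffineIndependent ℝ
      fun i ↦ EuclideanGeometry.inversion O r (T.points i) := by
    refine EuclideanGeometry.Cospherical.affineIndependent (s := Set.range _) ?_ subset_rfl
      ((EuclideanGeometry.inversion_injective O hr.ne').comp T.independent.injective)
    refine ⟨O + (r ^ 2 / T.circumsphere.power O) • (T.circumcenter - O), √((r ^ 2 /
      T.circumsphere.power O) ^ 2 * ‖T.circumcenter - O‖ ^ 2 -
        (r ^ 2 / T.circumsphere.power O) * r ^ 2), ?_⟩
    rintro _ ⟨i, rfl⟩
    rw [← norm_inversion_sub_sq (hne i) hP, Real.sqrt_sq (norm_nonneg _), ← dist_eq_norm]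
  exact ⟨⟨_, hind⟩, fun i ↦ ⟨hne i, rfl⟩⟩

/-- If `v` has power `-κ`, the power of `O` is an affine function of the circumcenter. -/
theorem power_eq_of_power_eq {T : Affine.Triangle ℝ ℂ} {v O : ℂ} {κ : ℝ}
    (h : T.circumsphere.power v = -κ) :
    T.circumsphere.power O =
      ‖O - T.circumcenter‖ ^ 2 - ‖v - T.circumcenter‖ ^ 2 - κ := by
  rw [EuclideanGeometry.Sphere.power, dist_eq_norm] at *
  rw [Affine.Simplex.circumsphere_center] at *
  linarith

/-! ### Conics, their tangents and projective changes of coordinates. -/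

section Conics

variable {F : Type*} [Field F]

theorem onConic_transpose_mul_mul (M N : Matrix (Fin 3) (Fin 3) F) (p : Fin 3 → F) :
    OnConic (Nᵀ * M * N) p ↔ OnConic M (N *ᵥ p) := by
  rw [OnConic, OnConic, ← Matrix.mulVec_mulVec, ← Matrix.mulVec_mulVec, Matrix.mulVec_transpose,
    dotProduct_comm, ← Matrix.dotProduct_mulVec, dotProduct_comm]

theorem onConic_smul (M : Matrix (Fin 3) (Fin 3) F) {s : F} (hs : s ≠ 0) (p : Fin 3 → F) :
    OnConic M (s • p) ↔ OnConic M p := by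
  simp [OnConic, Matrix.mulVec_smul, hs]

theorem isTangentLine_smul (M : Matrix (Fin 3) (Fin 3) F) {s : F} (hs : s ≠ 0) (u : Fin 3 → F) :
    IsTangentLine M (s • u) ↔ IsTangentLine M u := by
  constructor
  · rintro ⟨h, p, hp, hu⟩
    refine ⟨right_ne_zero_of_smul h, s⁻¹ • p, (onConic_smul M (inv_ne_zero hs) p).2 hp, ?_⟩
    rw [Matrix.mulVec_smul, ← hu, inv_smul_smul₀ hs]
  · rintro ⟨h, p, hp, hu⟩
    exact ⟨smul_ne_zero hs h, s • p, (onConic_smul M hs p).2 hp, by rw [Matrix.mulVec_smul, ← hu]⟩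

theorem mulVec_injective_of_det_ne_zero {N : Matrix (Fin 3) (Fin 3) F} (hN : N.det ≠ 0) :
    Function.Injective N.mulVec :=
  Matrix.mulVec_injective_of_isUnit ((Matrix.isUnit_iff_isUnit_det N).2 (isUnit_iff_ne_zero.2 hN))

theorem isTangentLine_transpose_mul_mul (M : Matrix (Fin 3) (Fin 3) F)
    {N : Matrix (Fin 3) (Fin 3) F} (hN : N.det ≠ 0) (u : Fin 3 → F) :
    IsTangentLine (Nᵀ * M * N) (Nᵀ *ᵥ u) ↔ IsTangentLine M u := by
  have hNt : Function.Injective Nᵀ.mulVec :=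
    mulVec_injective_of_det_ne_zero (by rwa [Matrix.det_transpose])
  have hu : Nᵀ *ᵥ u ≠ 0 ↔ u ≠ 0 := by
    rw [not_iff_not]
    exact ⟨fun h ↦ hNt (by simpa using h), fun h ↦ by simp [h]⟩
  rw [IsTangentLine, IsTangentLine, hu]
  refine and_congr_right fun _ ↦ ?_
  have hm : ∀ p, (Nᵀ * M * N) *ᵥ p = Nᵀ *ᵥ (M *ᵥ (N *ᵥ p)) := fun p ↦ by
    simp only [Matrix.mulVec_mulVec, Matrix.mul_assoc]
  constructor
  · rintro ⟨p, hp, h⟩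
    exact ⟨N *ᵥ p, (onConic_transpose_mul_mul _ _ _).1 hp, hNt (by simpa [hm] using h)⟩
  · rintro ⟨p, hp, h⟩
    have hpe : N *ᵥ (N⁻¹ *ᵥ p) = p := by
      rw [Matrix.mulVec_mulVec, Matrix.mul_nonsing_inv _ (isUnit_iff_ne_zero.2 hN),
        Matrix.one_mulVec]
    refine ⟨N⁻¹ *ᵥ p, (onConic_transpose_mul_mul _ _ _).2 (by rwa [hpe]), ?_⟩
    rw [hm, hpe, h]

/-- The adjugate is the matrix of the dual conic: adj(M)u is the pole of u up to a scalar, and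
tangency means that the pole lies on u. -/
theorem isTangentLine_of_adjugate {M : Matrix (Fin 3) (Fin 3) F} (hM : M.det ≠ 0) {u : Fin 3 → F}
    (hu : u ≠ 0) (h : (M.adjugate *ᵥ u) ⬝ᵥ u = 0) : IsTangentLine M u := by
  have e : M *ᵥ (M.adjugate *ᵥ u) = M.det • u := by
    rw [Matrix.mulVec_mulVec, Matrix.mul_adjugate, Matrix.smul_mulVec, Matrix.one_mulVec]
  rw [← isTangentLine_smul M hM]
  refine ⟨smul_ne_zero hM hu, M.adjugate *ᵥ u, ?_, e.symm⟩
  rw [OnConic, e, dotProduct_smul, h, smul_zero]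

end Conics

/-- A nondegenerate binary quadratic form over `ℂ` has two independent isotropic vectors. -/
theorem exists_two_isotropic {a b c : ℂ} (h : b ^ 2 - a * c ≠ 0) :
    ∃ x y x' y' : ℂ, x * y' - x' * y ≠ 0 ∧ a * x ^ 2 + 2 * b * (x * y) + c * y ^ 2 = 0 ∧
      a * x' ^ 2 + 2 * b * (x' * y') + c * y' ^ 2 = 0 := by
  by_cases ha : a = 0
  · subst ha
    have hb : b ≠ 0 := fun hb ↦ h (by simp [hb])
    exact ⟨1, 0, -c, 2 * b, by simp [hb], by ring, by ring⟩
  · obtain ⟨s, hs⟩ := IsAlgClosed.exists_pow_nat_eq (b ^ 2 - a * c) (n := 2) two_pos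
    have hs0 : s ≠ 0 := fun h0 ↦ h (by rw [← hs, h0]; ring)
    refine ⟨-b + s, a, -b - s, a, ?_, by linear_combination a * hs, by linear_combination a * hs⟩
    have : (-b + s) * a - (-b - s) * a = 2 * (s * a) := by ring
    rw [this]
    simp [hs0, ha]

/-- Two tangents from a point outside a nondegenerate complex conic. -/
theorem exists_two_tangents {M : Matrix (Fin 3) (Fin 3) ℂ} (hs : M.IsSymm) (hM : M.det ≠ 0)
    {x y : ℂ} (hO : ¬ OnConic M ![x, y, 1]) :
    ∃ u v : Fin 3 → ℂ, LinearIndependent ℂ ![u, v] ∧ u ⬝ᵥ ![x, y, 1] = 0 ∧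
      v ⬝ᵥ ![x, y, 1] = 0 ∧ IsTangentLine M u ∧ IsTangentLine M v := by
  have h10 := hs.apply 0 1
  have h20 := hs.apply 0 2
  have h21 := hs.apply 1 2
  have hdet := hM
  rw [Matrix.det_fin_three, h10, h20, h21] at hdet
  have key : ∀ X Y : ℂ, (M.adjugate *ᵥ ![X, Y, -(x * X + y * Y)]) ⬝ᵥ ![X, Y, -(x * X + y * Y)] =
      ((M 1 1 * M 2 2 - M 1 2 ^ 2) - 2 * x * (M 0 1 * M 1 2 - M 0 2 * M 1 1) +
        x ^ 2 * (M 0 0 * M 1 1 - M 0 1 ^ 2)) * X ^ 2 +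
      2 * ((M 0 2 * M 1 2 - M 0 1 * M 2 2) - y * (M 0 1 * M 1 2 - M 0 2 * M 1 1) -
        x * (M 0 1 * M 0 2 - M 0 0 * M 1 2) + x * y * (M 0 0 * M 1 1 - M 0 1 ^ 2)) * (X * Y) +
      ((M 0 0 * M 2 2 - M 0 2 ^ 2) - 2 * y * (M 0 1 * M 0 2 - M 0 0 * M 1 2) +
        y ^ 2 * (M 0 0 * M 1 1 - M 0 1 ^ 2)) * Y ^ 2 := fun X Y ↦ by
    rw [Matrix.adjugate_fin_three]
    simp only [Matrix.mulVec, dotProduct, Fin.sum_univ_three, Matrix.of_apply, Matrix.cons_val',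
      Matrix.cons_val_zero, Matrix.cons_val_one, Matrix.cons_val, h10, h20, h21]
    ring
  have hO' : OnConic M ![x, y, 1] ↔ M 0 0 * x ^ 2 + 2 * M 0 1 * x * y + M 1 1 * y ^ 2 +
      2 * M 0 2 * x + 2 * M 1 2 * y + M 2 2 = 0 := by
    rw [OnConic]
    simp only [Matrix.mulVec, dotProduct, Fin.sum_univ_three, Matrix.cons_val_zero,
      Matrix.cons_val_one, Matrix.cons_val, h10, h20, h21]
    ring_nf
  rw [hO'] at hO
  obtain ⟨X, Y, X', Y', hi, h1, h2⟩ := exists_two_isotropic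
    (a := (M 1 1 * M 2 2 - M 1 2 ^ 2) - 2 * x * (M 0 1 * M 1 2 - M 0 2 * M 1 1) +
        x ^ 2 * (M 0 0 * M 1 1 - M 0 1 ^ 2))
    (b := (M 0 2 * M 1 2 - M 0 1 * M 2 2) - y * (M 0 1 * M 1 2 - M 0 2 * M 1 1) -
        x * (M 0 1 * M 0 2 - M 0 0 * M 1 2) + x * y * (M 0 0 * M 1 1 - M 0 1 ^ 2))
    (c := (M 0 0 * M 2 2 - M 0 2 ^ 2) - 2 * y * (M 0 1 * M 0 2 - M 0 0 * M 1 2) +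
        y ^ 2 * (M 0 0 * M 1 1 - M 0 1 ^ 2)) (by
      intro h0
      -- The dual conic restricted to the pencil of lines through O is a binary form, with b² - ac
      -- equal to -det M times the value of M at O.
      refine mul_ne_zero hdet hO ?_
      linear_combination -h0)
  have tang : ∀ X Y : ℂ, (X ≠ 0 ∨ Y ≠ 0) →
      (M.adjugate *ᵥ ![X, Y, -(x * X + y * Y)]) ⬝ᵥ ![X, Y, -(x * X + y * Y)] = 0 →
      IsTangentLine M ![X, Y, -(x * X + y * Y)] := fun X Y hXY h ↦ by
    refine isTangentLine_of_adjugate hM (fun h0 ↦ ?_) h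
    have a := congrFun h0 0
    have b := congrFun h0 1
    simp at a b
    simp [a, b] at hXY
  have through : ∀ X Y : ℂ, ![X, Y, -(x * X + y * Y)] ⬝ᵥ ![x, y, 1] = 0 := fun X Y ↦ by
    simp [dotProduct, Fin.sum_univ_three]; ring
  refine ⟨![X, Y, -(x * X + y * Y)], ![X', Y', -(x * X' + y * Y')], ?_, through _ _, through _ _,
    tang _ _ ?_ ((key _ _).trans h1), tang _ _ ?_ ((key _ _).trans h2)⟩
  · rw [LinearIndependent.pair_iff]
    intro s t hst
    have a : s * X + t * X' = 0 := by simpa using congrFun hst 0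
    have b : s * Y + t * Y' = 0 := by simpa using congrFun hst 1
    constructor
    · exact (mul_eq_zero.1 (show s * (X * Y' - X' * Y) = 0 by
        linear_combination Y' * a - X' * b)).resolve_right hi
    · exact (mul_eq_zero.1 (show t * (X * Y' - X' * Y) = 0 by
        linear_combination X * b - Y * a)).resolve_right hi
  · by_contra! h
    exact hi (by simp [h.1, h.2])
  · by_contra! h
    exact hi (by simp [h.1, h.2])

/-! ### Matrices of affine maps, ellipses and circles. -/

/-- The matrix of an affine automorphism of the plane in homogeneous coordinates. -/
noncomputable def affineMatrix (φ : ℂ ≃ᵃ[ℝ] ℂ) : Matrix (Fin 3) (Fin 3) ℝ :=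
  !![(φ.linear 1).re, (φ.linear Complex.I).re, (φ 0).re;
     (φ.linear 1).im, (φ.linear Complex.I).im, (φ 0).im;
     0, 0, 1]

theorem affineMatrix_mulVec_homPt (φ : ℂ ≃ᵃ[ℝ] ℂ) (z : ℂ) :
    affineMatrix φ *ᵥ homPt z = homPt (φ z) := by
  have h : φ z = z.re • φ.linear 1 + z.im • φ.linear Complex.I + φ 0 := by
    have h0 : φ z = φ.linear z + φ 0 := by simpa using φ.map_vadd 0 z
    rw [h0, ← map_smul, ← map_smul, ← map_add]
    congr 2
    simp
  rw [h]
  ext i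
  fin_cases i <;> simp [affineMatrix, homPt, Matrix.mulVec, dotProduct, Fin.sum_univ_three] <;> ring

theorem eq_smul_homPt {p : Fin 3 → ℝ} (h : p 2 ≠ 0) :
    p = p 2 • homPt ⟨p 0 / p 2, p 1 / p 2⟩ := by
  ext i
  fin_cases i <;> simp [homPt] <;> field_simp

/-- The vectors of the points 0, 1, i form a basis. -/
theorem matrix_ext_homPt {M N : Matrix (Fin 3) (Fin 3) ℝ}
    (h : ∀ z, M *ᵥ homPt z = N *ᵥ homPt z) : M = N := by
  have h0 := h 0
  have h1 := h 1
  have hI := h Complex.I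
  ext i j
  have a := congrFun h0 i
  have b := congrFun h1 i
  have c := congrFun hI i
  simp [homPt, Matrix.mulVec, dotProduct, Fin.sum_univ_three] at a b c
  fin_cases j <;> simp <;> linarith

theorem affineMatrix_mul_symm (φ : ℂ ≃ᵃ[ℝ] ℂ) : affineMatrix φ * affineMatrix φ.symm = 1 :=
  matrix_ext_homPt fun z ↦ by
    rw [← Matrix.mulVec_mulVec, affineMatrix_mulVec_homPt, affineMatrix_mulVec_homPt,
      AffineEquiv.apply_symm_apply, Matrix.one_mulVec]

theorem affineMatrix_det_ne_zero (φ : ℂ ≃ᵃ[ℝ] ℂ) : (affineMatrix φ).det ≠ 0 := fun h ↦ by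
  have := congrArg Matrix.det (affineMatrix_mul_symm φ)
  simp [h] at this

theorem affineMatrix_mulVec_two (φ : ℂ ≃ᵃ[ℝ] ℂ) (p : Fin 3 → ℝ) : (affineMatrix φ *ᵥ p) 2 = p 2 := by
  simp [affineMatrix, Matrix.mulVec, dotProduct, Fin.sum_univ_three]

/-- The matrix of the ellipse `G(𝕋)`. -/
noncomputable def ellipseMatrix (G : ℂ ≃ᵃ[ℝ] ℂ) : Matrix (Fin 3) (Fin 3) ℝ :=
  (affineMatrix G.symm)ᵀ * circleMatrix 0 1 * affineMatrix G.symm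

theorem circleMatrix_isSymm (c : ℂ) (R : ℝ) : (circleMatrix c R).IsSymm := by
  ext i j
  fin_cases i <;> fin_cases j <;> simp [circleMatrix]

theorem circleMatrix_det (c : ℂ) (R : ℝ) : (circleMatrix c R).det = -R ^ 2 := by
  simp [circleMatrix, Matrix.det_fin_three]
  ring

theorem onConic_circleMatrix (c : ℂ) (R : ℝ) (p : Fin 3 → ℝ) :
    OnConic (circleMatrix c R) p ↔
      (p 0 - c.re * p 2) ^ 2 + (p 1 - c.im * p 2) ^ 2 = R ^ 2 * p 2 ^ 2 := by
  rw [OnConic, ← sub_eq_zero (a := _ + _)]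
  simp only [circleMatrix, Matrix.mulVec, dotProduct, Fin.sum_univ_three, Matrix.of_apply,
    Matrix.cons_val', Matrix.cons_val_zero, Matrix.cons_val_one, Matrix.cons_val]
  ring_nf

theorem isSymm_transpose_mul_mul {M : Matrix (Fin 3) (Fin 3) ℝ} (hM : M.IsSymm)
    (N : Matrix (Fin 3) (Fin 3) ℝ) : (Nᵀ * M * N).IsSymm := by
  rw [Matrix.IsSymm, Matrix.transpose_mul, Matrix.transpose_mul, Matrix.transpose_transpose, hM.eq,
    Matrix.mul_assoc]

theorem ellipseMatrix_isSymm (G : ℂ ≃ᵃ[ℝ] ℂ) : (ellipseMatrix G).IsSymm :=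
  isSymm_transpose_mul_mul (circleMatrix_isSymm 0 1) _

theorem ellipseMatrix_det_ne_zero (G : ℂ ≃ᵃ[ℝ] ℂ) : (ellipseMatrix G).det ≠ 0 := by
  simp [ellipseMatrix, circleMatrix_det, affineMatrix_det_ne_zero]

theorem onConic_ellipseMatrix_homPt (G : ℂ ≃ᵃ[ℝ] ℂ) (z : ℂ) :
    OnConic (ellipseMatrix G) (homPt z) ↔ z ∈ ellipse G := by
  obtain ⟨w, rfl⟩ := G.surjective z
  rw [mem_ellipse_apply, ellipseMatrix, onConic_transpose_mul_mul, affineMatrix_mulVec_homPt,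
    AffineEquiv.symm_apply_apply, onConic_circleMatrix, ← sq_eq_sq₀ (norm_nonneg _) zero_le_one,
    ← Complex.normSq_eq_norm_sq, Complex.normSq_apply]
  simp [homPt, sq]

/-- An ellipse has no real points at infinity. -/
theorem exists_homPt_of_onConic_ellipseMatrix {G : ℂ ≃ᵃ[ℝ] ℂ} {p : Fin 3 → ℝ} (hp : p ≠ 0)
    (h : OnConic (ellipseMatrix G) p) :
    ∃ (s : ℝ) (z : ℂ), s ≠ 0 ∧ z ∈ ellipse G ∧ p = s • homPt z := by
  have h2 : p 2 ≠ 0 := fun h2 ↦ by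
    rw [ellipseMatrix, onConic_transpose_mul_mul, onConic_circleMatrix, affineMatrix_mulVec_two,
      h2] at h
    simp at h
    have hq : affineMatrix G.symm *ᵥ p = 0 := by
      ext i
      fin_cases i
      · simp; nlinarith
      · simp; nlinarith
      · simp [affineMatrix_mulVec_two, h2]
    exact hp (mulVec_injective_of_det_ne_zero (affineMatrix_det_ne_zero _) (by simpa using hq))
  have e := eq_smul_homPt h2
  refine ⟨p 2, _, h2, ?_, e⟩
  rw [e, onConic_smul _ h2] at h
  exact (onConic_ellipseMatrix_homPt _ _).1 h

/-- An ellipse lies on one side of each of its tangents. -/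
theorem ellipseMatrix_bilin_nonpos {G : ℂ ≃ᵃ[ℝ] ℂ} {z w : ℂ} (hz : z ∈ ellipse G)
    (hw : w ∈ ellipse G) : (ellipseMatrix G *ᵥ homPt z) ⬝ᵥ homPt w ≤ 0 := by
  obtain ⟨z, rfl⟩ := G.surjective z
  obtain ⟨w, rfl⟩ := G.surjective w
  rw [mem_ellipse_apply] at hz hw
  rw [ellipseMatrix, ← Matrix.mulVec_mulVec, ← Matrix.mulVec_mulVec, affineMatrix_mulVec_homPt,
    AffineEquiv.symm_apply_apply, Matrix.mulVec_transpose, ← Matrix.dotProduct_mulVec,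
    affineMatrix_mulVec_homPt, AffineEquiv.symm_apply_apply]
  have hz2 : z.re * z.re + z.im * z.im = 1 := by
    rw [← Complex.normSq_apply, Complex.normSq_eq_norm_sq, hz, one_pow]
  have hw2 : w.re * w.re + w.im * w.im = 1 := by
    rw [← Complex.normSq_apply, Complex.normSq_eq_norm_sq, hw, one_pow]
  simp [circleMatrix, homPt, Matrix.mulVec, dotProduct, Fin.sum_univ_three]
  nlinarith [sq_nonneg (z.re - w.re), sq_nonneg (z.im - w.im)]

theorem homothetyMatrix_mulVec (k : ℝ) (p : Fin 3 → ℝ) :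
    homothetyMatrix k *ᵥ p = ![k * p 0, k * p 1, p 2] := by
  ext i
  fin_cases i <;> simp [homothetyMatrix, Matrix.mulVec_diagonal]

/-- Normal form of a real conic with real points, none of which is at infinity. -/
theorem exists_circle_normal_form {N : Matrix (Fin 3) (Fin 3) ℝ} (hs : N.IsSymm) (hN : N.det ≠ 0)
    (hinf : ∀ p, p ≠ 0 → OnConic N p → p 2 ≠ 0) (hne : ∃ p, p ≠ 0 ∧ OnConic N p) :
    ∃ (L : Matrix (Fin 3) (Fin 3) ℝ) (c : ℂ) (R : ℝ), 0 < R ∧ L.det ≠ 0 ∧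
      (∀ p, OnConic N p ↔ OnConic (circleMatrix c R) (L *ᵥ p)) ∧
      (∀ k p, L *ᵥ (homothetyMatrix k *ᵥ p) = homothetyMatrix k *ᵥ (L *ᵥ p)) ∧
      L *ᵥ homPt 0 = homPt 0 := by
  have h10 := hs.apply 0 1
  have h20 := hs.apply 0 2
  have h21 := hs.apply 1 2
  have hdet := hN
  rw [Matrix.det_fin_three, h10, h20, h21] at hdet
  have hon : ∀ p, OnConic N p ↔ N 0 0 * p 0 ^ 2 + 2 * N 0 1 * p 0 * p 1 + N 1 1 * p 1 ^ 2 +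
      2 * N 0 2 * p 0 * p 2 + 2 * N 1 2 * p 1 * p 2 + N 2 2 * p 2 ^ 2 = 0 := fun p ↦ by
    rw [OnConic]
    simp only [Matrix.mulVec, dotProduct, Fin.sum_univ_three, h10, h20, h21]
    ring_nf
  generalize N 0 0 = a at *
  generalize N 0 1 = h at *
  generalize N 1 1 = b at *
  generalize N 0 2 = g at *
  generalize N 1 2 = f at *
  generalize N 2 2 = e at *
  have ha : a ≠ 0 := fun ha ↦
    hinf ![1, 0, 0] (fun h0 ↦ by simpa using congrFun h0 0) ((hon _).2 (by simp [ha])) (by simp)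
  -- Otherwise the leading quadratic form has a real zero, which is a point of the conic at
  -- infinity.
  have hab : 0 < a * b - h ^ 2 := by
    by_contra! hle
    have hsq : √(h ^ 2 - a * b) ^ 2 = h ^ 2 - a * b := Real.sq_sqrt (by linarith)
    refine hinf ![-h + √(h ^ 2 - a * b), a, 0] (fun h0 ↦ ha (by simpa using congrFun h0 1))
      ((hon _).2 ?_) (by simp)
    simp
    linear_combination a * hsq
  set δ := √((a * b - h ^ 2) / a ^ 2)
  have hδ : 0 < δ := Real.sqrt_pos.2 (by positivity)
  have hδ2 : δ ^ 2 = (a * b - h ^ 2) / a ^ 2 := Real.sq_sqrt (by positivity)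
  have hδ3 : a ^ 2 * δ ^ 2 = a * b - h ^ 2 := by rw [hδ2]; field_simp
  obtain ⟨c₁, hc₁⟩ : ∃ c₁, a * c₁ = -g := ⟨-g / a, by field_simp⟩
  obtain ⟨c₂, hc₂⟩ : ∃ c₂, a * δ * c₂ = -(f + c₁ * h) := ⟨-(f + c₁ * h) / (a * δ), by field_simp⟩
  obtain ⟨ρ, hρ⟩ : ∃ ρ, a * ρ = a * (c₁ ^ 2 + c₂ ^ 2) - e :=
    ⟨(a * (c₁ ^ 2 + c₂ ^ 2) - e) / a, by field_simp⟩
  have key : ∀ x y t, a * x ^ 2 + 2 * h * x * y + b * y ^ 2 + 2 * g * x * t + 2 * f * y * t +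
      e * t ^ 2 = a * ((x + h / a * y - c₁ * t) ^ 2 + (δ * y - c₂ * t) ^ 2 - ρ * t ^ 2) :=
    fun x y t ↦ by
      have hh : a * (h / a) = h := by field_simp
      apply mul_left_cancel₀ ha
      linear_combination (-2 * a * x * y - a * (h / a) * y ^ 2 - h * y ^ 2 + 2 * a * c₁ * y * t) * hh -
        y ^ 2 * hδ3 + 2 * a * (x * t) * hc₁ + 2 * a * y * t * hc₂ + a * t ^ 2 * hρ
  -- The right side is -det N, so nondegeneracy gives ρ ≠ 0; a real point then gives ρ > 0.
  have hdetρ : a * ((a * b - h ^ 2) * ρ) =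
      -(a * (b * e - f ^ 2) - h * (h * e - f * g) + g * (h * f - b * g)) := by
    linear_combination (a * b - h ^ 2) * hρ - a * c₂ ^ 2 * hδ3 +
      a * (a * δ * c₂ - (f + c₁ * h)) * hc₂ + (b * (a * c₁ - g) + 2 * f * h) * hc₁
  have hρ0 : ρ ≠ 0 := fun h0 ↦ by
    rw [h0] at hdetρ
    apply hdet
    linear_combination hdetρ
  have hρpos : 0 < ρ := by
    obtain ⟨p, hp, hp'⟩ := hne
    have ht := hinf p hp hp'
    rw [hon, key] at hp'
    have h1 := (mul_eq_zero.1 hp').resolve_left ha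
    have h2 : 0 < p 2 ^ 2 := by positivity
    have h3 : 0 ≤ ρ * p 2 ^ 2 := by
      nlinarith [sq_nonneg (p 0 + h / a * p 1 - c₁ * p 2), sq_nonneg (δ * p 1 - c₂ * p 2)]
    exact lt_of_le_of_ne (nonneg_of_mul_nonneg_left h3 h2) hρ0.symm
  -- Completing squares in the leading form only: the map has no translation part, so it fixes the
  -- origin and commutes with homotheties centred there.
  refine ⟨!![1, h / a, 0; 0, δ, 0; 0, 0, 1], ⟨c₁, c₂⟩, √ρ, Real.sqrt_pos.2 hρpos, ?_,
    fun p ↦ ?_, fun k p ↦ ?_, ?_⟩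
  · simp [Matrix.det_fin_three, hδ.ne']
  · rw [hon, key, onConic_circleMatrix, Real.sq_sqrt hρpos.le, mul_eq_zero_iff_left ha, sub_eq_zero]
    simp [Matrix.mulVec, dotProduct, Fin.sum_univ_three]
  · rw [homothetyMatrix_mulVec, homothetyMatrix_mulVec]
    ext i
    fin_cases i <;> simp [Matrix.mulVec, dotProduct, Fin.sum_univ_three] <;> ring
  · ext i
    fin_cases i <;> simp [homPt, Matrix.mulVec, dotProduct, Fin.sum_univ_three]

theorem cplx_mul (M N : Matrix (Fin 3) (Fin 3) ℝ) : cplx (M * N) = cplx M * cplx N :=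
  Matrix.map_mul (f := Complex.ofRealHom)

theorem cplx_transpose (M : Matrix (Fin 3) (Fin 3) ℝ) : cplx Mᵀ = (cplx M)ᵀ :=
  rfl

theorem cplx_det (M : Matrix (Fin 3) (Fin 3) ℝ) : (cplx M).det = (M.det : ℂ) :=
  (RingHom.map_det Complex.ofRealHom M).symm

theorem onConic_cplx_homPtC (M : Matrix (Fin 3) (Fin 3) ℝ) (z : ℂ) :
    OnConic (cplx M) (homPtC z) ↔ OnConic M (homPt z) := by
  rw [OnConic, OnConic, ← Complex.ofReal_eq_zero]
  simp [cplx, homPtC, Matrix.mulVec, dotProduct, Fin.sum_univ_three]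

theorem homPtC_eq (z : ℂ) : homPtC z = ![(z.re : ℂ), (z.im : ℂ), 1] := by
  ext i
  fin_cases i <;> simp [homPtC, homPt]

/-- The tangent lines of a circle. -/
theorem isTangentLine_circleMatrix {c : ℂ} {R : ℝ} (hR : R ≠ 0) (u : Fin 3 → ℂ) :
    IsTangentLine (cplx (circleMatrix c R)) u ↔
      u ≠ 0 ∧ (u 0 * c.re + u 1 * c.im + u 2) ^ 2 = R ^ 2 * (u 0 ^ 2 + u 1 ^ 2) := by
  have hRC : (R : ℂ) ≠ 0 := by exact_mod_cast hR
  have hm : ∀ p, cplx (circleMatrix c R) *ᵥ p = ![p 0 - c.re * p 2, p 1 - c.im * p 2,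
      -c.re * p 0 - c.im * p 1 + (c.re ^ 2 + c.im ^ 2 - R ^ 2) * p 2] := fun p ↦ by
    ext i
    fin_cases i <;> simp [cplx, circleMatrix, Matrix.mulVec, dotProduct, Fin.sum_univ_three] <;>
      ring
  rw [IsTangentLine]
  refine and_congr_right fun _ ↦ ⟨?_, fun h ↦ ?_⟩
  · rintro ⟨p, hp, rfl⟩
    rw [OnConic, hm] at hp
    rw [hm]
    simp [dotProduct, Fin.sum_univ_three] at hp ⊢
    linear_combination -(R : ℂ) ^ 2 * hp
  · obtain ⟨t, ht⟩ : ∃ t, (R : ℂ) ^ 2 * t = -(u 0 * c.re + u 1 * c.im + u 2) :=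
      ⟨-(u 0 * c.re + u 1 * c.im + u 2) / (R : ℂ) ^ 2, by field_simp⟩
    have hu : u = cplx (circleMatrix c R) *ᵥ ![u 0 + c.re * t, u 1 + c.im * t, t] := by
      rw [hm]
      ext i
      fin_cases i
      · simp
      · simp
      · simp; linear_combination ht
    refine ⟨_, ?_, hu⟩
    rw [OnConic, ← hu]
    apply mul_left_cancel₀ (pow_ne_zero 2 hRC)
    simp only [dotProduct, Fin.sum_univ_three, Matrix.cons_val_zero, Matrix.cons_val_one,
      Matrix.cons_val]
    linear_combination -h + (u 0 * c.re + u 1 * c.im + u 2) * ht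

/-- The origin is the internal similitude centre of a circle and its image under a homothety of
negative ratio. -/
theorem isInternalSimilitudeCenter_zero (c : ℂ) {R k : ℝ} (hR : 0 < R) (hk : k < 0) :
    IsInternalSimilitudeCenter c (k * c) R (-k * R) 0 := by
  have hR' : -k * R ≠ 0 := by nlinarith
  have hRC : (R : ℂ) ≠ 0 := by exact_mod_cast hR.ne'
  have hkC : (k : ℂ) ≠ 0 := by exact_mod_cast hk.ne
  have hk1 : (1 - k : ℂ) ≠ 0 := by
    norm_cast
    linarith
  have h0 : ∀ u : Fin 3 → ℂ, u ⬝ᵥ homPtC 0 = u 2 := fun u ↦ by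
    simp [homPtC_eq, dotProduct, Fin.sum_univ_three]
  have hcenter : ∀ u : Fin 3 → ℂ, (((-k * R : ℝ) : ℂ) * (u ⬝ᵥ homPtC c) =
      -((R : ℂ) * (u ⬝ᵥ homPtC (k * c)))) ↔ u 2 = 0 := fun u ↦ by
    have e : ((-k * R : ℝ) : ℂ) * (u ⬝ᵥ homPtC c) - -((R : ℂ) * (u ⬝ᵥ homPtC (k * c))) =
        R * (1 - k) * u 2 := by
      simp [homPtC_eq, dotProduct, Fin.sum_univ_three]
      ring
    rw [← sub_eq_zero, e, mul_eq_zero_iff_left (mul_ne_zero hRC hk1)]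
  have ht : ∀ u : Fin 3 → ℂ, u 2 = 0 → (IsTangentLine (cplx (circleMatrix c R)) u ↔
      IsTangentLine (cplx (circleMatrix (k * c) (-k * R))) u) := fun u hu ↦ by
    rw [isTangentLine_circleMatrix hR.ne', isTangentLine_circleMatrix hR']
    refine and_congr_right fun _ ↦ ?_
    have e : (u 0 * (k * c : ℂ).re + u 1 * (k * c : ℂ).im + u 2) ^ 2 -
        ((-k * R : ℝ) : ℂ) ^ 2 * (u 0 ^ 2 + u 1 ^ 2) =
        k ^ 2 * ((u 0 * c.re + u 1 * c.im + u 2) ^ 2 - R ^ 2 * (u 0 ^ 2 + u 1 ^ 2)) := by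
      simp [hu]
      ring
    rw [← sub_eq_zero, ← sub_eq_zero (b := ((-k * R : ℝ) : ℂ) ^ 2 * _), e,
      mul_eq_zero_iff_left (pow_ne_zero 2 hkC)]
  intro u
  rw [IsInternalCommonTangent, h0, hcenter]
  constructor
  · constructor
    · rintro ⟨h1, -, h3⟩
      exact ⟨h3, h1⟩
    · rintro ⟨h3, h1⟩
      exact ⟨h1, (ht u h3).1 h1, h3⟩
  · constructor
    · rintro ⟨-, h2, h3⟩
      exact ⟨h3, h2⟩
    · rintro ⟨h3, h2⟩
      exact ⟨(ht u h3).2 h2, h2, h3⟩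

theorem onConic_circleMatrix_homothety (c : ℂ) (R : ℝ) {k : ℝ} (hk : k ≠ 0) (p : Fin 3 → ℝ) :
    OnConic (circleMatrix (k * c) (-k * R)) (homothetyMatrix k *ᵥ p) ↔
      OnConic (circleMatrix c R) p := by
  rw [onConic_circleMatrix, onConic_circleMatrix, homothetyMatrix_mulVec]
  simp only [Complex.re_ofReal_mul, Complex.im_ofReal_mul, Matrix.cons_val_zero,
    Matrix.cons_val_one, Matrix.cons_val]
  refine ⟨fun h ↦ mul_left_cancel₀ (pow_ne_zero 2 hk) ?_, fun h ↦ ?_⟩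
  · linear_combination h
  · linear_combination k ^ 2 * h

/-! ### Homologies, and the chart in which they become homotheties. -/

/-- The matrix of the homology `p ↦ a p + (m ⬝ p) o`, with centre `o` and axis `m`. -/
def homologyMatrix (a : ℝ) (o m : Fin 3 → ℝ) : Matrix (Fin 3) (Fin 3) ℝ :=
  a • (1 : Matrix (Fin 3) (Fin 3) ℝ) + Matrix.vecMulVec o m

theorem homologyMatrix_apply (a : ℝ) (o m : Fin 3 → ℝ) (i j : Fin 3) :
    homologyMatrix a o m i j = a * (1 : Matrix (Fin 3) (Fin 3) ℝ) i j + o i * m j := by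
  simp [homologyMatrix, Matrix.vecMulVec_apply]

theorem homologyMatrix_mulVec (a : ℝ) (o m p : Fin 3 → ℝ) :
    homologyMatrix a o m *ᵥ p = a • p + (m ⬝ᵥ p) • o := by
  rw [homologyMatrix, Matrix.add_mulVec, Matrix.smul_mulVec, Matrix.one_mulVec,
    Matrix.vecMulVec_mulVec]
  simp

theorem homologyMatrix_det (a : ℝ) (o m : Fin 3 → ℝ) :
    (homologyMatrix a o m).det = a ^ 2 * (a + m ⬝ᵥ o) := by
  simp [homologyMatrix, Matrix.det_fin_three, Matrix.vecMulVec_apply, dotProduct,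
    Fin.sum_univ_three]
  ring

/-- The term (m ⬝ p) o of the homology contributes nothing when u vanishes at o. The statement is
complex because tangents from O may be non-real. -/
theorem cplx_homologyMatrix_transpose_mulVec {a : ℝ} {m : Fin 3 → ℝ} {O : ℂ} {u : Fin 3 → ℂ}
    (hu : u ⬝ᵥ homPtC O = 0) : (cplx (homologyMatrix a (homPt O) m))ᵀ *ᵥ u = (a : ℂ) • u := by
  simp [homPtC_eq, dotProduct, Fin.sum_univ_three] at hu
  ext i
  fin_cases i <;> simp [homologyMatrix_apply, cplx, Matrix.mulVec, dotProduct, Fin.sum_univ_three,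
    homPt]
  · linear_combination m 0 * hu
  · linear_combination m 1 * hu
  · linear_combination m 2 * hu

/-- The image of the conic `M` under the projective transformation `H`. -/
noncomputable def conicImage (H M : Matrix (Fin 3) (Fin 3) ℝ) : Matrix (Fin 3) (Fin 3) ℝ :=
  (H⁻¹)ᵀ * M * H⁻¹

section

variable {H M : Matrix (Fin 3) (Fin 3) ℝ}

theorem inv_mulVec_mulVec (hH : H.det ≠ 0) (p : Fin 3 → ℝ) : H⁻¹ *ᵥ (H *ᵥ p) = p := by
  rw [Matrix.mulVec_mulVec, Matrix.nonsing_inv_mul _ (isUnit_iff_ne_zero.2 hH), Matrix.one_mulVec]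

theorem mulVec_inv_mulVec (hH : H.det ≠ 0) (p : Fin 3 → ℝ) : H *ᵥ (H⁻¹ *ᵥ p) = p := by
  rw [Matrix.mulVec_mulVec, Matrix.mul_nonsing_inv _ (isUnit_iff_ne_zero.2 hH), Matrix.one_mulVec]

theorem onConic_conicImage (p : Fin 3 → ℝ) : OnConic (conicImage H M) p ↔ OnConic M (H⁻¹ *ᵥ p) :=
  onConic_transpose_mul_mul _ _ _

theorem onConic_conicImage_mulVec (hH : H.det ≠ 0) (p : Fin 3 → ℝ) :
    OnConic (conicImage H M) (H *ᵥ p) ↔ OnConic M p := by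
  rw [onConic_conicImage, inv_mulVec_mulVec hH]

theorem conicImage_isSymm (hM : M.IsSymm) : (conicImage H M).IsSymm :=
  isSymm_transpose_mul_mul hM _

theorem conicImage_det_ne_zero (hH : H.det ≠ 0) (hM : M.det ≠ 0) : (conicImage H M).det ≠ 0 := by
  simp [conicImage, hH, hM]

theorem transpose_mul_conicImage_mul (hH : H.det ≠ 0) : Hᵀ * conicImage H M * H = M := by
  have h := Matrix.nonsing_inv_mul _ (isUnit_iff_ne_zero.2 hH)
  rw [conicImage, Matrix.mul_assoc, Matrix.mul_assoc, h, Matrix.mul_one, ← Matrix.mul_assoc,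
    ← Matrix.transpose_mul, h, Matrix.transpose_one, Matrix.one_mul]

end

theorem homPt_ne_zero (z : ℂ) : homPt z ≠ 0 := fun h ↦ by simpa [homPt] using congrFun h 2

theorem homPt_injective : Function.Injective homPt := fun z w h ↦
  Complex.ext (by simpa [homPt] using congrFun h 0) (by simpa [homPt] using congrFun h 1)

theorem dotProduct_homPt (u : Fin 3 → ℝ) (z : ℂ) :
    u ⬝ᵥ homPt z = u 0 * z.re + u 1 * z.im + u 2 := by
  simp [homPt, dotProduct, Fin.sum_univ_three]

section Homology

variable {a : ℝ} {O : ℂ} {m : Fin 3 → ℝ} {M : Matrix (Fin 3) (Fin 3) ℝ}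

theorem homology_mulVec_center :
    homologyMatrix a (homPt O) m *ᵥ homPt O = (a + m ⬝ᵥ homPt O) • homPt O := by
  rw [homologyMatrix_mulVec, add_smul]

theorem homology_det_ne_zero (ha : a ≠ 0) (hd : a + m ⬝ᵥ homPt O ≠ 0) :
    (homologyMatrix a (homPt O) m).det ≠ 0 := by
  rw [homologyMatrix_det]
  exact mul_ne_zero (pow_ne_zero 2 ha) hd

/-- A homology with centre `O` preserves the lines through `O`, hence the tangents from `O`. -/
theorem commonTangentsMeetAt_homology (ha : a ≠ 0) (hd : a + m ⬝ᵥ homPt O ≠ 0) (hs : M.IsSymm)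
    (hM : M.det ≠ 0) :
    CommonTangentsMeetAt M (conicImage (homologyMatrix a (homPt O) m) M) O := by
  have hH := homology_det_ne_zero ha hd
  have h1 : ∀ u : Fin 3 → ℂ, u ⬝ᵥ homPtC O = 0 → (IsTangentLine (cplx M) u ↔
      IsTangentLine (cplx (conicImage (homologyMatrix a (homPt O) m) M)) u) := fun u hu ↦ by
    have haC : (a : ℂ) ≠ 0 := by exact_mod_cast ha
    have hHC : (cplx (homologyMatrix a (homPt O) m)).det ≠ 0 := by
      rw [cplx_det]; exact_mod_cast hH
    rw [← isTangentLine_transpose_mul_mul (cplx (conicImage _ M)) hHC, ← cplx_transpose, ← cplx_mul, ← cplx_mul,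
      transpose_mul_conicImage_mul hH, cplx_transpose, cplx_homologyMatrix_transpose_mulVec hu,
      isTangentLine_smul _ haC]
  refine ⟨h1, ?_, fun hO ↦ ?_⟩
  · rw [← onConic_smul (conicImage _ M) hd, ← homology_mulVec_center,
      onConic_conicImage_mulVec hH]
  · rw [← onConic_cplx_homPtC, homPtC_eq] at hO
    have hsC : (cplx M).IsSymm := by
      rw [Matrix.IsSymm, ← cplx_transpose, hs.eq]
    obtain ⟨u, v, hi, hu, hv, htu, htv⟩ := exists_two_tangents hsC
      (by rw [cplx_det]; exact_mod_cast hM) hO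
    rw [← homPtC_eq] at hu hv
    exact ⟨u, v, hi, hu, hv, htu, (h1 u hu).1 htu, htv, (h1 v hv).1 htv⟩

/-- The projective transformation which sends the centre `O` of a homology to the origin and its
axis `m` to the line at infinity. -/
noncomputable def homologyChart (O : ℂ) (m : Fin 3 → ℝ) : Matrix (Fin 3) (Fin 3) ℝ :=
  !![1, 0, -O.re; 0, 1, -O.im;
    m 0 / (m ⬝ᵥ homPt O), m 1 / (m ⬝ᵥ homPt O), m 2 / (m ⬝ᵥ homPt O)]

theorem homologyChart_mulVec (p : Fin 3 → ℝ) : homologyChart O m *ᵥ p =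
    ![p 0 - O.re * p 2, p 1 - O.im * p 2, (m ⬝ᵥ p) / (m ⬝ᵥ homPt O)] := by
  ext i
  fin_cases i
  · simp [homologyChart, Matrix.mulVec, dotProduct, Fin.sum_univ_three]; ring
  · simp [homologyChart, Matrix.mulVec, dotProduct, Fin.sum_univ_three]; ring
  · change ![m 0 / (m ⬝ᵥ homPt O), m 1 / (m ⬝ᵥ homPt O), m 2 / (m ⬝ᵥ homPt O)] ⬝ᵥ p =
      (m ⬝ᵥ p) / (m ⬝ᵥ homPt O)
    generalize m ⬝ᵥ homPt O = μ
    simp only [dotProduct, Fin.sum_univ_three, Matrix.cons_val_zero, Matrix.cons_val_one,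
      Matrix.cons_val]
    ring

theorem homologyChart_det (hm : m ⬝ᵥ homPt O ≠ 0) : (homologyChart O m).det = 1 := by
  have : (homologyChart O m).det = (m ⬝ᵥ homPt O) / (m ⬝ᵥ homPt O) := by
    conv_rhs => enter [1]; rw [dotProduct_homPt]
    simp [homologyChart, Matrix.det_fin_three]
    ring
  rw [this, div_self hm]

theorem homologyChart_mulVec_center (hm : m ⬝ᵥ homPt O ≠ 0) :
    homologyChart O m *ᵥ homPt O = homPt 0 := by
  rw [homologyChart_mulVec, div_self hm]
  ext i
  fin_cases i <;> simp [homPt]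

/-- The ratio is the quotient of the two eigenvalues of the homology: a on the axis and a + m ⬝ O at
the centre. -/
theorem homologyChart_mulVec_homology (hm : m ⬝ᵥ homPt O ≠ 0) (hd : a + m ⬝ᵥ homPt O ≠ 0)
    (p : Fin 3 → ℝ) :
    homologyChart O m *ᵥ (homologyMatrix a (homPt O) m *ᵥ p) = (a + m ⬝ᵥ homPt O) •
      (homothetyMatrix (a / (a + m ⬝ᵥ homPt O)) *ᵥ (homologyChart O m *ᵥ p)) := by
  rw [homologyMatrix_mulVec, Matrix.mulVec_add, Matrix.mulVec_smul, Matrix.mulVec_smul,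
    homologyChart_mulVec_center hm, homologyChart_mulVec, homothetyMatrix_mulVec]
  generalize m ⬝ᵥ homPt O = μ at *
  ext i
  fin_cases i
  · simp [homPt]; field_simp
  · simp [homPt]; field_simp
  · simp [homPt]; field_simp

theorem isInternalSimilitudeChart_homology (ha : 0 < a) (hd : a + m ⬝ᵥ homPt O < 0) :
    IsInternalSimilitudeChart M (conicImage (homologyMatrix a (homPt O) m) M) O
      (homologyChart O m) (a / (a + m ⬝ᵥ homPt O)) := by
  have hm : m ⬝ᵥ homPt O ≠ 0 := by linarith
  have hS : (homologyChart O m).det ≠ 0 := by rw [homologyChart_det hm]; exact one_ne_zero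
  refine ⟨hS, div_neg_of_pos_of_neg ha hd, homologyChart_mulVec_center hm, fun p q h ↦ ?_⟩
  have e : (a + m ⬝ᵥ homPt O) • q = homologyMatrix a (homPt O) m *ᵥ p := by
    apply mulVec_injective_of_det_ne_zero hS
    rw [Matrix.mulVec_smul, h, homologyChart_mulVec_homology hm hd.ne]
  rw [← onConic_smul (conicImage _ M) hd.ne, e,
    onConic_conicImage_mulVec (homology_det_ne_zero ha.ne' hd.ne)]

/-- If the axis of the homology misses the conic `M`, then `M` and its image can be sent to
circles. -/
theorem isInternalSimilitudeCenterViaCircles_homology (ha : 0 < a) (hd : a + m ⬝ᵥ homPt O < 0)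
    (hs : M.IsSymm) (hM : M.det ≠ 0) (hne : ∃ p, p ≠ 0 ∧ OnConic M p)
    (haxis : ∀ p, p ≠ 0 → OnConic M p → m ⬝ᵥ p ≠ 0) :
    IsInternalSimilitudeCenterViaCircles M (conicImage (homologyMatrix a (homPt O) m) M) O := by
  have hm : m ⬝ᵥ homPt O ≠ 0 := by linarith
  have hS : (homologyChart O m).det ≠ 0 := by rw [homologyChart_det hm]; exact one_ne_zero
  have hH := homology_det_ne_zero ha.ne' hd.ne
  have hk : a / (a + m ⬝ᵥ homPt O) < 0 := div_neg_of_pos_of_neg ha hd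
  -- The chart puts the axis at infinity, so a conic missing the axis becomes one with no real point
  -- at infinity.
  obtain ⟨L, c, R, hR, hL, hLc, hLk, hL0⟩ := exists_circle_normal_form
    (N := conicImage (homologyChart O m) M) (conicImage_isSymm hs) (conicImage_det_ne_zero hS hM)
    (fun p hp h ↦ by
      rw [onConic_conicImage] at h
      have hq : (homologyChart O m)⁻¹ *ᵥ p ≠ 0 := fun h0 ↦ hp (by
        rw [← mulVec_inv_mulVec hS p, h0, Matrix.mulVec_zero])
      rw [← mulVec_inv_mulVec hS p, homologyChart_mulVec]
      exact div_ne_zero (haxis _ hq h) hm)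
    (by
      obtain ⟨p, hp, hp'⟩ := hne
      refine ⟨homologyChart O m *ᵥ p, fun h0 ↦ hp ?_, (onConic_conicImage_mulVec hS p).2 hp'⟩
      exact mulVec_injective_of_det_ne_zero hS (by simpa using h0))
  have h1 : ∀ p, OnConic M p ↔ OnConic (circleMatrix c R) ((L * homologyChart O m) *ᵥ p) :=
    fun p ↦ by rw [← Matrix.mulVec_mulVec, ← hLc, onConic_conicImage_mulVec hS]
  refine ⟨L * homologyChart O m, c, _, R, _, 0, ?_, hR, ?_, h1, fun p ↦ ?_,
    ⟨1, one_ne_zero, ?_⟩, isInternalSimilitudeCenter_zero c hR hk⟩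
  · rw [Matrix.det_mul]; exact mul_ne_zero hL hS
  · exact mul_pos (neg_pos.2 hk) hR
  · obtain ⟨q, rfl⟩ : ∃ q, homologyMatrix a (homPt O) m *ᵥ q = p := ⟨_, mulVec_inv_mulVec hH p⟩
    rw [onConic_conicImage_mulVec hH, h1, ← onConic_circleMatrix_homothety c R hk.ne,
      ← Matrix.mulVec_mulVec, ← Matrix.mulVec_mulVec, homologyChart_mulVec_homology hm hd.ne,
      Matrix.mulVec_smul, hLk, onConic_smul _ hd.ne]
  · rw [← Matrix.mulVec_mulVec, homologyChart_mulVec_center hm, hL0, one_smul]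

end Homology

/-! ### Assembly of the theorem. -/

/-- A linear form vanishing on an ellipse vanishes identically. -/
theorem exists_mem_ellipse_dotProduct_ne_zero (G : ℂ ≃ᵃ[ℝ] ℂ) {w : Fin 3 → ℝ} {O : ℂ}
    (hO : w ⬝ᵥ homPt O ≠ 0) : ∃ z ∈ ellipse G, w ⬝ᵥ homPt z ≠ 0 := by
  by_contra! h
  have h' : ∀ z, ‖z‖ = 1 → (w ᵥ* affineMatrix G) ⬝ᵥ homPt z = 0 := fun z hz ↦ by
    rw [← Matrix.dotProduct_mulVec, affineMatrix_mulVec_homPt]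
    exact h _ (mem_ellipse_apply.2 hz)
  have a := h' 1 (by simp)
  have b := h' (-1) (by simp)
  have c := h' Complex.I (by simp)
  obtain ⟨z, rfl⟩ := G.surjective O
  apply hO
  rw [← affineMatrix_mulVec_homPt, Matrix.dotProduct_mulVec]
  rw [dotProduct_homPt] at a b c ⊢
  simp at a b c
  have e0 : (w ᵥ* affineMatrix G) 0 = 0 := by linarith
  have e2 : (w ᵥ* affineMatrix G) 2 = 0 := by linarith
  have e1 : (w ᵥ* affineMatrix G) 1 = 0 := by linarith
  rw [e0, e1, e2]
  ring

theorem mainTheorem3 (A B : ℂ ≃ᵃ[ℝ] ℂ)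
    (hnested : ellipse B ⊆ ellipseInside A)
    (hnoncircular : ¬ ∃ (c : ℂ) (ρ : ℝ), ellipse A = Metric.sphere c ρ)
    (hfamily : ∃ T : Affine.Triangle ℝ ℂ, IsPonceletTriangle A B T)
    (O : ℂ) (r : ℝ) (hr : 0 < r) :
    ∃ M M' : Matrix (Fin 3) (Fin 3) ℝ,
      IsConicWithMatrix (circumLocus A B) M ∧
      IsConicWithMatrix (invCircumLocus A B O r) M' ∧
      -- the tangents from `O` to the two loci coincide, so two common tangents meet at `O`
      CommonTangentsMeetAt M M' O ∧
      -- after a projective transformation, the loci correspond in a homothety of negative ratio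
      -- centred at `O`, and this homothety is the map from `X₃` to `X₃'`
      (∃ (S : Matrix (Fin 3) (Fin 3) ℝ) (k : ℝ), IsInternalSimilitudeChart M M' O S k ∧
        ∀ T T' : Affine.Triangle ℝ ℂ, IsPonceletTriangle A B T → IsInversiveTriangle O r T T' →
          ∃ s : ℝ, s ≠ 0 ∧
            S *ᵥ homPt T'.circumcenter =
              s • (homothetyMatrix k *ᵥ (S *ᵥ homPt T.circumcenter))) ∧
      -- if no circumcircle is orthogonal to the inversion circle, the two loci can be sent to circles
      -- with the image of `O` as their internal similitude centre
      ((∀ T : Affine.Triangle ℝ ℂ, IsPonceletTriangle A B T → T.circumsphere.power O ≠ r ^ 2) →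
        IsInternalSimilitudeCenterViaCircles M M' O) ∧
      -- if `O` is inside all circumcircles, the real tangents from `O` separate the two loci
      ((∀ T : Affine.Triangle ℝ ℂ, IsPonceletTriangle A B T → T.circumsphere.power O < 0) →
        ∀ u : Fin 3 → ℝ, u ⬝ᵥ homPt O = 0 → IsTangentLine M u →
          ∀ X ∈ circumLocus A B, ∀ X' ∈ invCircumLocus A B O r,
            (u ⬝ᵥ homPt X) * (u ⬝ᵥ homPt X') ≤ 0) := by
  obtain ⟨G, v, κ, hκ, hG, hv⟩ := exists_constant_power A B hnested hnoncircular hfamily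
  have hr2 : 0 < r ^ 2 := pow_pos hr 2
  -- The form m is the power of O minus r², written through the constant power -κ of v; its zero
  -- line is the axis.
  set m : Fin 3 → ℝ := ![2 * (v.re - O.re), 2 * (v.im - O.im),
    O.re ^ 2 + O.im ^ 2 - v.re ^ 2 - v.im ^ 2 - κ - r ^ 2] with hm
  have hmX : ∀ X, r ^ 2 + m ⬝ᵥ homPt X = ‖O - X‖ ^ 2 - ‖v - X‖ ^ 2 - κ := fun X ↦ by
    rw [dotProduct_homPt, ← Complex.normSq_eq_norm_sq, ← Complex.normSq_eq_norm_sq,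
      Complex.normSq_apply, Complex.normSq_apply]
    simp [hm]
    ring
  have hpow : ∀ T, IsPonceletTriangle A B T →
      T.circumsphere.power O = r ^ 2 + m ⬝ᵥ homPt T.circumcenter := fun T hT ↦ by
    rw [hmX, power_eq_of_power_eq (hv T hT)]
  -- At X = O only -|v - O|² - κ remains. This sign makes the similitude internal.
  have hd : r ^ 2 + m ⬝ᵥ homPt O < 0 := by
    rw [hmX, sub_self, norm_zero]
    nlinarith [sq_nonneg ‖v - O‖]
  have hmO : m ⬝ᵥ homPt O ≠ 0 := by linarith
  have hH := homology_det_ne_zero (m := m) hr2.ne' hd.ne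
  have hinv : ∀ T T', IsPonceletTriangle A B T → IsInversiveTriangle O r T T' →
      T.circumsphere.power O • homPt T'.circumcenter =
        homologyMatrix (r ^ 2) (homPt O) m *ᵥ homPt T.circumcenter := fun T T' hT hT' ↦ by
    have hP := hT'.power_ne_zero hr
    rw [hT'.circumcenter_eq hr, homologyMatrix_mulVec]
    have : m ⬝ᵥ homPt T.circumcenter = T.circumsphere.power O - r ^ 2 := by
      rw [hpow T hT]; ring
    rw [this]
    generalize r ^ 2 = a
    ext i
    fin_cases i
    · simp [homPt]; field_simp; ring
    · simp [homPt]; field_simp; ring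
    · simp [homPt]
  have hlocus : ∀ p, p ≠ 0 → OnConic (ellipseMatrix G) p → ∃ (s : ℝ) (T : Affine.Triangle ℝ ℂ),
      s ≠ 0 ∧ IsPonceletTriangle A B T ∧ T.circumcenter ∈ ellipse G ∧
        p = s • homPt T.circumcenter := fun p hp h ↦ by
    obtain ⟨s, z, hs, hz, rfl⟩ := exists_homPt_of_onConic_ellipseMatrix hp h
    obtain ⟨T, hT, rfl⟩ := hG ▸ hz
    exact ⟨s, T, hs, hT, hz, rfl⟩
  refine ⟨ellipseMatrix G, conicImage (homologyMatrix (r ^ 2) (homPt O) m) (ellipseMatrix G),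
    ⟨ellipseMatrix_isSymm G, ellipseMatrix_det_ne_zero G, ?_, ?_⟩,
    ⟨conicImage_isSymm (ellipseMatrix_isSymm G),
      conicImage_det_ne_zero hH (ellipseMatrix_det_ne_zero G), ?_, ?_⟩,
    commonTangentsMeetAt_homology hr2.ne' hd.ne (ellipseMatrix_isSymm G)
      (ellipseMatrix_det_ne_zero G),
    ⟨_, _, isInternalSimilitudeChart_homology hr2 hd, fun T T' hT hT' ↦ ?_⟩, fun horth ↦ ?_,
    fun hinside u hu ⟨hu0, p, hp, hup⟩ X hX X' hX' ↦ ?_⟩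
  · obtain ⟨T, hT⟩ := hfamily
    exact ⟨_, T, hT, rfl⟩
  · ext z
    rw [hG, Set.mem_ofPred_eq, onConic_ellipseMatrix_homPt]
  -- The form w is the power of O as a function of X; some circumcircle must avoid O for an
  -- inversive triangle to exist.
  · obtain ⟨z, hz, hz'⟩ := exists_mem_ellipse_dotProduct_ne_zero G
      (w := m + ![0, 0, r ^ 2]) (O := O) (by
        rw [add_dotProduct]
        have : (![0, 0, r ^ 2] : Fin 3 → ℝ) ⬝ᵥ homPt O = r ^ 2 := by
          rw [dotProduct_homPt]; simp
        rw [this, add_comm]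
        exact hd.ne)
    obtain ⟨T, hT, rfl⟩ := hG ▸ hz
    obtain ⟨T', hT'⟩ := exists_isInversiveTriangle hr (T := T) (O := O) (by
      rw [hpow T hT]
      rw [add_dotProduct] at hz'
      have : (![0, 0, r ^ 2] : Fin 3 → ℝ) ⬝ᵥ homPt T.circumcenter = r ^ 2 := by
        rw [dotProduct_homPt]; simp
      rwa [this, add_comm] at hz')
    exact ⟨_, T, T', hT, hT', rfl⟩
  · ext z
    rw [Set.mem_ofPred_eq]
    constructor
    · rintro ⟨T, T', hT, hT', rfl⟩
      rw [← onConic_smul _ (hT'.power_ne_zero hr), hinv T T' hT hT', onConic_conicImage_mulVec hH,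
        onConic_ellipseMatrix_homPt, ← hG]
      exact ⟨T, hT, rfl⟩
    · intro h
      rw [onConic_conicImage] at h
      obtain ⟨s, T, hs, hT, -, hsT⟩ := hlocus _ (fun h0 ↦ homPt_ne_zero z (by
        rw [← mulVec_inv_mulVec hH (homPt z), h0, Matrix.mulVec_zero])) h
      have e : homPt z = s • (homologyMatrix (r ^ 2) (homPt O) m *ᵥ homPt T.circumcenter) := by
        rw [← Matrix.mulVec_smul, ← hsT, mulVec_inv_mulVec hH]
      -- The third coordinate shows that an affine point of the image conic comes from a
      -- circumcircle with nonzero power of O; zero power corresponds to points at infinity.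
      have e2 : s * T.circumsphere.power O = 1 := by
        have := congrFun e 2
        rw [homologyMatrix_mulVec] at this
        simp [homPt] at this
        rw [hpow T hT, this]
        simp [homPt]
      obtain ⟨T', hT'⟩ := exists_isInversiveTriangle hr (right_ne_zero_of_mul_eq_one e2)
      refine ⟨T, T', hT, hT', homPt_injective ?_⟩
      rw [e, ← hinv T T' hT hT', smul_smul, e2, one_smul]
  · have hP := hT'.power_ne_zero hr
    refine ⟨(r ^ 2 + m ⬝ᵥ homPt O) / T.circumsphere.power O, div_ne_zero hd.ne hP, ?_⟩
    have := homologyChart_mulVec_homology hmO hd.ne (homPt T.circumcenter)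
    rw [← hinv T T' hT hT', Matrix.mulVec_smul] at this
    rw [div_eq_inv_mul, mul_smul, ← this, inv_smul_smul₀ hP]
  · refine isInternalSimilitudeCenterViaCircles_homology hr2 hd (ellipseMatrix_isSymm G)
      (ellipseMatrix_det_ne_zero G) ⟨homPt (G 1), homPt_ne_zero _, ?_⟩ fun p hp h ↦ ?_
    · rw [onConic_ellipseMatrix_homPt, mem_ellipse_apply, norm_one]
    · obtain ⟨s, T, hs, hT, -, rfl⟩ := hlocus p hp h
      rw [dotProduct_smul]
      refine smul_ne_zero hs fun h0 ↦ horth T hT ?_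
      rw [hpow T hT, h0, add_zero]
  · obtain ⟨T₁, T', hT₁, hT', rfl⟩ := hX'
    rw [hG] at hX
    have hX₁ : T₁.circumcenter ∈ ellipse G := hG ▸ ⟨T₁, hT₁, rfl⟩
    -- An ellipse has no real points at infinity, so the point of contact is itself a circumcenter.
    obtain ⟨s, T₀, hs, hT₀, hX₀, rfl⟩ := hlocus p (fun h0 ↦ hu0 (by
      rw [hup, h0, Matrix.mulVec_zero])) hp
    have hux : ∀ X, u ⬝ᵥ homPt X =
        s * ((ellipseMatrix G *ᵥ homPt T₀.circumcenter) ⬝ᵥ homPt X) := fun X ↦ by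
      rw [hup, Matrix.mulVec_smul, smul_dotProduct, smul_eq_mul]
    have hn := ellipseMatrix_bilin_nonpos hX₀ hX
    have hn₁ := ellipseMatrix_bilin_nonpos hX₀ hX₁
    -- Since u vanishes at O, pairing the homology with u gives P·u(X₃') = r²·u(X₃), and P < 0
    -- reverses the sign.
    have e := congrArg (fun x ↦ u ⬝ᵥ x) (hinv T₁ T' hT₁ hT')
    simp only [homologyMatrix_mulVec, dotProduct_smul, dotProduct_add, hu, smul_eq_mul, mul_zero,
      add_zero] at e
    have hneg := hinside T₁ hT₁
    rw [hux T₁.circumcenter] at e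
    rw [hux X]
    refine nonpos_of_mul_nonneg_left (b := T₁.circumsphere.power O) ?_ hneg
    generalize (ellipseMatrix G *ᵥ homPt T₀.circumcenter) ⬝ᵥ homPt X = α at *
    generalize (ellipseMatrix G *ᵥ homPt T₀.circumcenter) ⬝ᵥ homPt T₁.circumcenter = β at *
    have : s * α * u ⬝ᵥ homPt T'.circumcenter * T₁.circumsphere.power O =
        r ^ 2 * s ^ 2 * (α * β) := by linear_combination s * α * e
    rw [this]
    exact mul_nonneg (by positivity) (mul_nonneg_of_nonpos_of_nonpos hn hn₁)
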